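/- \begin{theorem}[Inner ball finding] Write $B(x,\rho)$ for the closed Euclidean ball in $\mathbb{R}^d$. A separation oracle for a set $K\subseteq\mathbb{R}^d$ is a (measurable) map $\mathcal{O}$ that, on a query $u\in\mathbb{R}^d$, asserts $u\in K$ if $u\in K$, and otherwise returns a closed halfspace $\mathcal{H}=\{x:\langle a,x\rangle\le b\}$ with $a\neq 0$, $K\subseteq\mathcal{H}$ and $\langle a,u\rangle\ge b$. There is a universal constant $C>0$ such that the following holds for every $d\ge 1$, all $r,R>0$, every convex set $K\subseteq\mathbb{R}^d$ with $B(z,r)\subseteq K\subseteq B(0,R)$ for some $z\in\mathbb{R}^d$, and every separation oracle $\mathcal{O}$ for $K$. Consider the following algorithm, whose input is $d,r,R$ and access to $\mathcal{O}$. Set $K_{\mathrm{out}}\leftarrow B(0,R)$ and repeat: \begin{enumerate} \item Let $v$ be the center of gravity of $K_{\mathrm{out}}$, sample $u$ uniformly from $B(v,\frac{r}{6d})$ with fresh independent randomness, and query $\mathcal{O}(u)$. \item If $\mathcal{O}$ asserts $u\in K$, query $\mathcal{O}$ at each of the $2d$ points of $S=\{u\pm\frac{r}{6d^{3}}e_i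 : 1\le i\le d\}$. If $S\subseteq K$, stop and return $x=u$, the center of the inscribed ball of $\mathrm{conv}(S)$. If $S\not\subseteq K$, leave $K_{\mathrm{out}}$ unchanged. \item If $\mathcal{O}$ returns a halfspace $\mathcal{H}$ at $u$, set $K_{\mathrm{out}}\leftarrow K_{\mathrm{out}}\cap\mathcal{H}$. \end{enumerate} Then \begin{itemize} \item whenever the algorithm returns a point $x$, it satisfies $B\bigl(x,\frac{r}{6d^{3.5}}\bigr)\subseteq K$; \item the algorithm terminates with probability $1$; \item the number of oracle calls is a random variable with expectation at most $C\,d\,(1+\log(R/r))$; in particular, it is $O(d\log(R/r))$ whenever $R\ge 2r$. \end{itemize} \end{theorem} -/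

import Mathlib

open MeasureTheory ProbabilityTheory Set
open scoped ENNReal

noncomputable section

namespace InnerBall

/-- `ℝ^d` with the Euclidean norm. -/
abbrev Space (d : ℕ) := EuclideanSpace ℝ (Fin d)

/-- An answer of a separation oracle: `Sum.inl ()` asserts membership of the queried point, and
`Sum.inr (a, b)` stands for the closed halfspace `{x | ⟪a, x⟫ ≤ b}`. -/
abbrev Answer (d : ℕ) := Unit ⊕ (Space d × ℝ)

/-- The closed halfspace `{x | ⟪a, x⟫ ≤ b}`. -/
def halfspace {d : ℕ} (a : Space d) (b : ℝ) : Set (Space d) := {x | inner ℝ a x ≤ b}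

/-- `O` is a separation oracle for `K`: on a query `u` it asserts `u ∈ K` if this is the case, and
otherwise it returns a hyperplane `⟪a, x⟫ = b` (with `a ≠ 0`) that separates `u` from `K`. -/
def IsSeparationOracle {d : ℕ} (K : Set (Space d)) (O : Space d → Answer d) : Prop :=
  ∀ u, (u ∈ K → O u = Sum.inl ()) ∧
    (u ∉ K → ∃ (a : Space d) (b : ℝ), O u = Sum.inr (a, b) ∧ a ≠ 0 ∧
      K ⊆ halfspace a b ∧ b ≤ inner ℝ a u)

/-- Programs with access to an oracle that answers queries in `Q` by elements of `A`. A program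
gets to know the oracle only through the answers to its queries. -/
inductive OracleProg (Q A : Type) (α : Type) : Type
  | pure (x : α) : OracleProg Q A α
  | ask (q : Q) (k : A → OracleProg Q A α) : OracleProg Q A α

/-- Apply a function to the result of a program. -/
def OracleProg.map {Q A α β : Type} (f : α → β) : OracleProg Q A α → OracleProg Q A β
  | .pure x => .pure (f x)
  | .ask q k => .ask q fun a => (k a).map f

/-- Run a program with the oracle `O`: its result, and the number of oracle calls made. -/
def OracleProg.run {Q A α : Type} (O : Q → A) : OracleProg Q A α → α × ℕ
  | .pure x => (x, 0)
  | .ask q k => (((k (O q)).run O).1, ((k (O q)).run O).2 + 1)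

/-- Query every point of a list, and report whether all of them were asserted to lie in the set
(and the flag `ok` was `true` at the start). -/
def checkAll {d : ℕ} : List (Space d) → Bool → OracleProg (Space d) (Answer d) Bool
  | [], ok => .pure ok
  | s :: l, ok => .ask s fun ans => checkAll l (ok && ans.isLeft)

/-- The `2 d` points `u ± δ eᵢ`, where `eᵢ` are the standard unit vectors. -/
def testPoints {d : ℕ} (u : Space d) (δ : ℝ) : List (Space d) :=
  (List.finRange d).flatMap fun i =>
    [u + δ • EuclideanSpace.single i (1 : ℝ), u - δ • EuclideanSpace.single i (1 : ℝ)]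

/-- The center of gravity `vol(A)⁻¹ ∫_A x dx`. -/
def centerOfGravity {d : ℕ} (A : Set (Space d)) : Space d := ⨍ x in A, x

/-- One iteration of the loop of the algorithm, on the current outer set `Kout` and the random
displacement `ξ`, which is uniform in the ball of radius `r / (6 d)` around `0`. The result is
either the returned point (`Sum.inl`) or the outer set for the next iteration (`Sum.inr`).
The point `u` is the center of the inscribed ball of the cross-polytope that is spanned by
`testPoints u (r / (6 d ^ 3))`. If `u` is asserted to lie in the set, there is no halfspace to
cut with, and `Kout` stays as it is. -/
def iteration {d : ℕ} (r : ℝ) (Kout : Set (Space d)) (ξ : Space d) :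
    OracleProg (Space d) (Answer d) (Space d ⊕ Set (Space d)) :=
  let u := centerOfGravity Kout + ξ
  .ask u fun
    | .inr (a, b) => .pure (.inr (Kout ∩ halfspace a b))
    | .inl _ => (checkAll (testPoints u (r / (6 * (d : ℝ) ^ 3))) true).map fun ok =>
        if ok then .inl u else .inr Kout

/-- The state of the algorithm after (at most) `n` iterations, when it draws the displacements
`ξ 0, ξ 1, …`: the returned point or the current outer set, and the number of oracle calls so far.
After the algorithm has returned, the state does not change any more. -/
def loop {d : ℕ} (O : Space d → Answer d) (R r : ℝ) (ξ : ℕ → Space d) :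
    ℕ → (Space d ⊕ Set (Space d)) × ℕ
  | 0 => (.inr (Metric.closedBall 0 R), 0)
  | n + 1 =>
    match loop O R r ξ n with
    | (.inl x, c) => (.inl x, c)
    | (.inr Kout, c) =>
      (((iteration r Kout (ξ n)).run O).1, c + ((iteration r Kout (ξ n)).run O).2)

/-- With the displacements `ξ`, the algorithm terminates and returns `x`. -/
def Outputs {d : ℕ} (O : Space d → Answer d) (R r : ℝ) (ξ : ℕ → Space d) (x : Space d) : Prop :=
  ∃ n, (loop O R r ξ n).1 = .inl x

/-- The total number of oracle calls that the algorithm makes with the displacements `ξ`. -/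
def oracleCalls {d : ℕ} (O : Space d → Answer d) (R r : ℝ) (ξ : ℕ → Space d) : ℝ≥0∞ :=
  ⨆ n, ((loop O R r ξ n).2 : ℝ≥0∞)

/-- The law of the random displacements: independent, and each of them uniformly distributed in
the ball of radius `r / (6 d)` around `0`. -/
def displacementLaw (d : ℕ) (r : ℝ) : Measure (ℕ → Space d) :=
  Measure.infinitePi fun _ => cond volume (Metric.closedBall (0 : Space d) (r / (6 * d)))

end InnerBall

end

/-!
An iteration either cuts the outer set, or returns, or fails: the queried point `u` is in `K` but
one of the test points around it is not. The argument is a supermartingale estimate for the number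
of oracle calls so far plus a potential, which is affine in the logarithm of the volume of the outer
set. It rests on two facts about convex bodies.

*A cut removes at least `1 / 40` of the volume* (`measureReal_inter_halfspace_le`), although the
halfspace may miss the center of gravity by `r / (6 d)`. The volume above a level of a linear
functional is log-concave in the level, by the Brunn–Minkowski inequality, which comes from the
Prékopa–Leindler inequality (`prekopaLeindler`). A slab of width `2 r / (3 d)` contains at most half
of the volume, by contractions towards the two extreme points (`measureReal_slab_le`). So the body
is spread out on the scale of the displacement, and if only a tiny fraction were far above the
center of gravity, log-concavity would leave too little moment to balance the part below it.

*A failure has probability at most `55 / d`, and at most a constant less than `1`*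
(`stepLaw_failSet_le`). The first bound pays for the `2 d` calls of a failed test. A failing point
is within `ρ / d ^ 2` of the boundary of `K`, where `ρ = r / (6 d)` is the radius of the ball that
is sampled from. The reflection `2 P - 1` in a convex set with projection `P` is nonexpansive and
maps the outer shell along the boundary onto the inner one. Iterated over the neighbourhoods of `K`,
this finds `d` disjoint shells of at least the same volume inside a ball of radius `(1 + 4 / d) ρ`
(`mul_measureReal_near_boundary_le`). The second bound holds for large `d` by the first one, and
for small `d` because some ball of radius `ρ / 8` contains no failing point.

The oracle is only almost everywhere measurable. The queried point has an absolutely continuous law,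
since the displacement is independent of the past, and this makes the state of the algorithm almost
everywhere measurable (`measurable_state`). Independence enters as the invariance of the law of the
displacements under resampling of one coordinate (`measurePreserving_update`).
-/

namespace InnerBall

/-! ### The Prékopa–Leindler inequality for midpoints -/

open scoped Pointwise in
/-- The one-dimensional Brunn–Minkowski inequality for midpoints. For compact sets, a translate of
`A` by the least element of `B` and a translate of `B` by the largest element of `A` both lie
in `A + B` and meet in a single point. -/
theorem volume_add_volume_le_two_mul {A B C : Set ℝ} (hA : MeasurableSet A) (hB : MeasurableSet B)
    (hAne : A.Nonempty) (hBne : B.Nonempty) (h : ∀ a ∈ A, ∀ b ∈ B, (a + b) / 2 ∈ C) :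
    volume A + volume B ≤ 2 * volume C := by
  have compact_case : ∀ A' B' : Set ℝ, A' ⊆ A → B' ⊆ B → IsCompact A' → IsCompact B' →
      A'.Nonempty → B'.Nonempty → volume A' + volume B' ≤ 2 * volume C := by
    intro A' B' hA' hB' cA cB nA nB
    set a := sSup A'
    set b := sInf B'
    have ha : a ∈ A' := cA.sSup_mem nA
    have hb : b ∈ B' := cB.sInf_mem nB
    have hdisj : AEDisjoint volume ((fun x => x + b) '' A') ((fun x => a + x) '' B') := by
      refine measure_mono_null (t := {a + b}) ?_ (by simp)
      rintro _ ⟨⟨x, hx, rfl⟩, ⟨y, hy, hxy⟩⟩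
      have h1 : x ≤ a := le_csSup cA.bddAbove hx
      have h2 : b ≤ y := csInf_le cB.bddBelow hy
      simp only [mem_singleton_iff] at *
      linarith
    have hm : MeasurableSet ((fun x => a + x) '' B') :=
      (cB.image (continuous_const.add continuous_id)).measurableSet
    have hsub : ((fun x => x + b) '' A') ∪ ((fun x => a + x) '' B') ⊆ (2 : ℝ) • C := by
      rintro _ (⟨x, hx, rfl⟩ | ⟨y, hy, rfl⟩)
      · refine ⟨(x + b) / 2, h _ (hA' hx) _ (hB' hb), ?_⟩
        simp only [smul_eq_mul]; ring
      · refine ⟨(a + y) / 2, h _ (hA' ha) _ (hB' hy), ?_⟩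
        simp only [smul_eq_mul]; ring
    have h1 := measure_mono (μ := volume) hsub
    rw [measure_union₀ hm.nullMeasurableSet hdisj, Measure.addHaar_smul] at h1
    have e1 : volume ((fun x => x + b) '' A') = volume A' := by
      simp [image_add_right, measure_preimage_add_right]
    have e2 : volume ((fun x => a + x) '' B') = volume B' := by
      simp [image_add_left, measure_preimage_add]
    rw [e1, e2] at h1
    simpa using h1
  obtain ⟨a₀, ha₀⟩ := hAne
  obtain ⟨b₀, hb₀⟩ := hBne
  rw [hA.measure_eq_iSup_isCompact volume, hB.measure_eq_iSup_isCompact volume]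
  simp only [iSup_and']
  refine ENNReal.biSup_add_biSup_le' ⟨∅, by simp⟩ ⟨∅, by simp⟩ ?_
  rintro A' ⟨hA', cA⟩ B' ⟨hB', cB⟩
  refine le_trans (add_le_add (measure_mono (subset_insert a₀ A'))
    (measure_mono (subset_insert b₀ B'))) ?_
  exact compact_case _ _ (insert_subset ha₀ hA') (insert_subset hb₀ hB') (cA.insert _)
    (cB.insert _) (insert_nonempty _ _) (insert_nonempty _ _)

/-- The additive form of the inequality, for functions whose supremum is `1`. The superlevel sets
satisfy the one-dimensional Brunn–Minkowski inequality; integrate over the levels. -/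
theorem lintegral_add_lintegral_le_of_sup_eq_one {f g h : ℝ → ℝ} (hf : Measurable f)
    (hg : Measurable g) (hh : Measurable h) (f0 : ∀ x, 0 ≤ f x) (g0 : ∀ x, 0 ≤ g x)
    (h0 : ∀ x, 0 ≤ h x) (f1 : ∀ x, f x ≤ 1) (g1 : ∀ x, g x ≤ 1) (fs : ∀ t < 1, ∃ x, t < f x)
    (gs : ∀ t < 1, ∃ x, t < g x) (H : ∀ x y, f x * g y ≤ h ((x + y) / 2) ^ 2) :
    (∫⁻ x, ENNReal.ofReal (f x)) + ∫⁻ x, ENNReal.ofReal (g x) ≤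
      2 * ∫⁻ x, ENNReal.ofReal (h x) := by
  rw [lintegral_eq_lintegral_meas_lt _ (ae_of_all _ f0) hf.aemeasurable,
    lintegral_eq_lintegral_meas_lt _ (ae_of_all _ g0) hg.aemeasurable,
    lintegral_eq_lintegral_meas_lt _ (ae_of_all _ h0) hh.aemeasurable]
  have mono : ∀ u : ℝ → ℝ, Measurable fun t => volume {a | t < u a} := fun u =>
    Antitone.measurable fun s t hst => measure_mono fun x hx => lt_of_le_of_lt hst hx
  rw [← lintegral_add_left (mono f), ← lintegral_const_mul _ (mono h)]
  refine setLIntegral_mono' measurableSet_Ioi fun t ht => ?_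
  rcases lt_or_ge t 1 with h1 | h1
  · refine volume_add_volume_le_two_mul (measurableSet_lt measurable_const hf)
      (measurableSet_lt measurable_const hg) (fs t h1) (gs t h1) fun a ha b hb => ?_
    have ht' : (0 : ℝ) < t := ht
    simp only [mem_ofPred_eq] at ha hb ⊢
    refine lt_of_pow_lt_pow_left₀ 2 (h0 _) (lt_of_lt_of_le ?_ (H a b))
    nlinarith
  · have e1 : {a | t < f a} = ∅ := by
      ext x; simpa using (f1 x).trans h1
    have e2 : {a | t < g a} = ∅ := by
      ext x; simpa using (g1 x).trans h1
    simp [e1, e2]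

/-- The one-dimensional inequality for bounded functions, reduced to the additive form by dividing
`f`, `g` by their suprema `a`, `b` and `h` by `√(a b)`. -/
theorem prekopaLeindler_real_of_bounded {f g h : ℝ → ℝ≥0∞} (hf : Measurable f) (hg : Measurable g)
    (hh : Measurable h) {M : ℝ≥0∞} (hM : M ≠ ∞) (fM : ∀ x, f x ≤ M) (gM : ∀ x, g x ≤ M)
    (H : ∀ x y, f x * g y ≤ h ((x + y) / 2) ^ 2) :
    (∫⁻ x, f x) * ∫⁻ x, g x ≤ (∫⁻ x, h x) ^ 2 := by
  set a := ⨆ x, f x with ha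
  set b := ⨆ x, g x with hb
  have aM : a ≠ ∞ := ne_top_of_le_ne_top hM (iSup_le fM)
  have bM : b ≠ ∞ := ne_top_of_le_ne_top hM (iSup_le gM)
  have fa : ∀ x, f x ≤ a := le_iSup f
  have gb : ∀ x, g x ≤ b := le_iSup g
  by_cases a0 : a = 0
  · have : ∀ x, f x = 0 := fun x => le_antisymm ((fa x).trans a0.le) zero_le
    simp [this]
  by_cases b0 : b = 0
  · have : ∀ x, g x = 0 := fun x => le_antisymm ((gb x).trans b0.le) zero_le
    simp [this]
  set c : ℝ≥0∞ := (a * b) ^ (1 / 2 : ℝ) with hc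
  have cc : c ^ 2 = a * b := by
    rw [hc, ← ENNReal.rpow_natCast, ← ENNReal.rpow_mul]; norm_num
  have c0 : c ≠ 0 := fun h => by simp [h, a0, b0] at cc
  have cM : c ≠ ∞ := fun h => by
    have := ENNReal.mul_ne_top aM bM
    simp [h] at cc; exact this cc.symm
  have key : ∀ (u : ℝ → ℝ≥0∞) (e : ℝ≥0∞), e ≠ 0 → e ≠ ∞ → (∀ x, u x ≤ e) → Measurable u →
      ∫⁻ x, u x = e * ∫⁻ x, ENNReal.ofReal (u x / e).toReal := by
    intro u e e0 eM ue hu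
    rw [← lintegral_const_mul _ (by fun_prop)]
    refine lintegral_congr fun x => ?_
    rw [ENNReal.ofReal_toReal (ENNReal.div_ne_top (ne_top_of_le_ne_top eM (ue x)) e0),
      ENNReal.mul_div_cancel e0 eM]
  have le1 : ∀ (u e : ℝ≥0∞), u ≤ e → (u / e).toReal ≤ 1 := by
    intro u e hue
    refine ENNReal.toReal_le_of_le_ofReal zero_le_one ?_
    simpa using ENNReal.div_le_of_le_mul (by simpa using hue)
  have sup1 : ∀ (u : ℝ → ℝ≥0∞), (⨆ x, u x) ≠ 0 → (⨆ x, u x) ≠ ∞ → ∀ t : ℝ, t < 1 →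
      ∃ x, t < (u x / ⨆ x, u x).toReal := by
    intro u u0 uM t ht
    have h1 : ENNReal.ofReal t * (⨆ x, u x) < ⨆ x, u x := by
      conv_rhs => rw [← one_mul (⨆ x, u x)]
      exact ENNReal.mul_lt_mul_left u0 uM (by simpa using ht)
    obtain ⟨x, hx⟩ := lt_iSup_iff.1 h1
    refine ⟨x, ?_⟩
    have h2 : ENNReal.ofReal t < u x / ⨆ x, u x :=
      (ENNReal.lt_div_iff_mul_lt (Or.inl u0) (Or.inl uM)).2 hx
    by_contra! hcon
    have := ENNReal.ofReal_le_ofReal hcon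
    rw [ENNReal.ofReal_toReal (ENNReal.div_ne_top
      (ne_top_of_le_ne_top uM (le_iSup u x)) u0)] at this
    exact absurd h2 (not_lt.2 this)
  have main := lintegral_add_lintegral_le_of_sup_eq_one (f := fun x => (f x / a).toReal)
    (g := fun x => (g x / b).toReal) (h := fun x => (min (h x) c / c).toReal)
    (by fun_prop) (by fun_prop) (by fun_prop) (fun _ => ENNReal.toReal_nonneg)
    (fun _ => ENNReal.toReal_nonneg) (fun _ => ENNReal.toReal_nonneg) (fun x => le1 _ _ (fa x))
    (fun x => le1 _ _ (gb x)) (sup1 f a0 aM) (sup1 g b0 bM) (by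
      intro x y
      rw [← ENNReal.toReal_mul, ← ENNReal.toReal_pow]
      refine ENNReal.toReal_mono ?_ ?_
      · exact ENNReal.pow_ne_top (ENNReal.div_ne_top (ne_top_of_le_ne_top cM (min_le_right _ _)) c0)
      · rw [ENNReal.div_eq_inv_mul, ENNReal.div_eq_inv_mul, ENNReal.div_eq_inv_mul, mul_pow,
          ← ENNReal.inv_pow, cc, mul_mul_mul_comm, ENNReal.mul_inv (Or.inl a0) (Or.inl aM)]
        refine mul_le_mul_right ?_ _
        rcases le_total (h ((x + y) / 2)) c with h1 | h1
        · rw [min_eq_left h1]; exact H x y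
        · rw [min_eq_right h1, cc]; exact mul_le_mul' (fa x) (gb y))
  have hmin : ∫⁻ x, min (h x) c ≤ ∫⁻ x, h x := lintegral_mono fun x => min_le_left _ _
  refine le_trans ?_ (pow_le_pow_left' hmin 2)
  rw [key f a a0 aM fa hf, key g b b0 bM gb hg,
    key (fun x => min (h x) c) c c0 cM (fun x => min_le_right _ _) (by fun_prop)]
  generalize ∫⁻ x, ENNReal.ofReal (f x / a).toReal = I at *
  generalize ∫⁻ x, ENNReal.ofReal (g x / b).toReal = J at *
  generalize ∫⁻ x, ENNReal.ofReal (min (h x) c / c).toReal = K at *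
  rw [mul_pow, cc, mul_mul_mul_comm]
  refine mul_le_mul_right ?_ _
  by_cases hK : K = ∞
  · simp [hK]
  have hIJ : I + J ≠ ∞ := ne_top_of_le_ne_top (ENNReal.mul_ne_top (by simp) hK) main
  obtain ⟨hI, hJ⟩ := ENNReal.add_ne_top.1 hIJ
  lift I to NNReal using hI
  lift J to NNReal using hJ
  lift K to NNReal using hK
  norm_cast at main ⊢
  have m' : (I : ℝ) + J ≤ 2 * K := by exact_mod_cast main
  have : (I : ℝ) * J ≤ (K : ℝ) ^ 2 := by
    nlinarith [sq_nonneg ((I : ℝ) - J), I.coe_nonneg, J.coe_nonneg, K.coe_nonneg]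
  exact_mod_cast this

theorem prekopaLeindler_real {f g h : ℝ → ℝ≥0∞} (hf : Measurable f) (hg : Measurable g)
    (hh : Measurable h) (H : ∀ x y, f x * g y ≤ h ((x + y) / 2) ^ 2) :
    (∫⁻ x, f x) * ∫⁻ x, g x ≤ (∫⁻ x, h x) ^ 2 := by
  have trunc : ∀ u : ℝ → ℝ≥0∞, Measurable u →
      Monotone (fun n : ℕ => ∫⁻ x, min (u x) n) ∧ ⨆ n : ℕ, ∫⁻ x, min (u x) n = ∫⁻ x, u x := by
    intro u hu
    have mono : Monotone fun (n : ℕ) x => min (u x) (n : ℝ≥0∞) := fun m n hmn x =>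
      min_le_min le_rfl (by exact_mod_cast hmn)
    refine ⟨fun m n hmn => lintegral_mono (mono hmn), ?_⟩
    rw [← lintegral_iSup (fun n => by fun_prop) mono]
    refine lintegral_congr fun x => ?_
    rw [← inf_iSup_eq, ENNReal.iSup_natCast, inf_top_eq]
  rw [← (trunc f hf).2, ← (trunc g hg).2, ENNReal.iSup_mul]
  refine iSup_le fun m => ?_
  rw [ENNReal.mul_iSup]
  refine iSup_le fun n => ?_
  refine le_trans (mul_le_mul' ((trunc f hf).1 (le_max_left m n))
    ((trunc g hg).1 (le_max_right m n))) ?_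
  refine prekopaLeindler_real_of_bounded (by fun_prop) (by fun_prop) hh
    (M := ((max m n : ℕ) : ℝ≥0∞)) (ENNReal.natCast_ne_top _) (fun x => min_le_right _ _)
    (fun x => min_le_right _ _) fun x y => ?_
  exact le_trans (mul_le_mul' (min_le_left _ _) (min_le_left _ _)) (H x y)

/-- The **Prékopa–Leindler inequality** for midpoints, by induction on the dimension: the
integrals over all coordinates but the first satisfy the hypothesis in dimension one. -/
theorem prekopaLeindler (n : ℕ) {f g h : (Fin n → ℝ) → ℝ≥0∞} (hf : Measurable f)
    (hg : Measurable g) (hh : Measurable h)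
    (H : ∀ x y, f x * g y ≤ h ((1 / 2 : ℝ) • (x + y)) ^ 2) :
    (∫⁻ x, f x) * ∫⁻ x, g x ≤ (∫⁻ x, h x) ^ 2 := by
  induction n with
  | zero =>
    have e : ∀ u : (Fin 0 → ℝ) → ℝ≥0∞, ∫⁻ x, u x = u 0 := fun u => by
      rw [volume_pi, Measure.pi_of_empty _ 0, lintegral_dirac]
    rw [e, e, e]
    simpa using H 0 0
  | succ n ih =>
    let e := MeasurableEquiv.piFinSuccAbove (fun _ : Fin (n + 1) => ℝ) 0
    have he : MeasurePreserving e.symm volume volume :=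
      (volume_preserving_piFinSuccAbove (fun _ : Fin (n + 1) => ℝ) 0).symm
    have split : ∀ u : (Fin (n + 1) → ℝ) → ℝ≥0∞, Measurable u →
        ∫⁻ x, u x = ∫⁻ s : ℝ, ∫⁻ y : Fin n → ℝ, u (e.symm (s, y)) := by
      intro u hu
      rw [← he.lintegral_comp hu]
      exact lintegral_prod _ (hu.comp e.symm.measurable).aemeasurable
    have meas : ∀ u : (Fin (n + 1) → ℝ) → ℝ≥0∞, Measurable u →
        Measurable fun s : ℝ => ∫⁻ y : Fin n → ℝ, u (e.symm (s, y)) := fun u hu =>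
      (hu.comp e.symm.measurable).lintegral_prod_right'
    rw [split f hf, split g hg, split h hh]
    refine prekopaLeindler_real (meas f hf) (meas g hg) (meas h hh) fun s t => ?_
    refine ih (hf.comp (e.symm.measurable.comp measurable_prodMk_left))
      (hg.comp (e.symm.measurable.comp measurable_prodMk_left))
      (hh.comp (e.symm.measurable.comp measurable_prodMk_left)) fun x y => ?_
    have : e.symm ((s + t) / 2, (1 / 2 : ℝ) • (x + y)) =
        (1 / 2 : ℝ) • (e.symm (s, x) + e.symm (t, y)) := by
      ext i
      refine Fin.cases ?_ (fun j => ?_) i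
      · simp [e, MeasurableEquiv.piFinSuccAbove]; ring
      · simp [e, MeasurableEquiv.piFinSuccAbove, mul_add]
    rw [this]
    exact H _ _

/-- The multiplicative **Brunn–Minkowski inequality** for midpoints. -/
theorem volume_mul_volume_le_sq {d : ℕ} {A B C : Set (Space d)} (hA : MeasurableSet A)
    (hB : MeasurableSet B) (hC : MeasurableSet C) (h : ∀ a ∈ A, ∀ b ∈ B, midpoint ℝ a b ∈ C) :
    volume A * volume B ≤ volume C ^ 2 := by
  have mp := PiLp.volume_preserving_toLp (Fin d)
  have ind : ∀ S : Set (Space d), MeasurableSet S →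
      volume S = ∫⁻ x : Fin d → ℝ, S.indicator 1 (WithLp.toLp 2 x) := fun S hS => by
    rw [mp.lintegral_comp (measurable_one.indicator hS), lintegral_indicator_one hS]
  have m : ∀ S : Set (Space d), MeasurableSet S →
      Measurable fun x : Fin d → ℝ => S.indicator (1 : Space d → ℝ≥0∞) (WithLp.toLp 2 x) :=
    fun S hS => (measurable_one.indicator hS).comp mp.measurable
  rw [ind A hA, ind B hB, ind C hC]
  refine prekopaLeindler d (m A hA) (m B hB) (m C hC) fun x y => ?_
  by_cases hx : WithLp.toLp 2 x ∈ A
  · by_cases hy : WithLp.toLp 2 y ∈ B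
    · have := h _ hx _ hy
      rw [midpoint_eq_smul_add] at this
      have hz : WithLp.toLp 2 ((1 / 2 : ℝ) • (x + y)) ∈ C := by
        convert this using 1
        ext i; simp [mul_add]
      rw [indicator_of_mem hx, indicator_of_mem hy, indicator_of_mem hz]
      simp
    · simp [indicator_of_notMem hy]
  · simp [indicator_of_notMem hx]

/-! ### Halfspaces near the center of gravity cut off a constant fraction -/

variable {d : ℕ}

/-- If the contraction by the factor `1 - q` towards `p` maps `U` into `W`, then `W` contains all
of the volume of `U` but a fraction `d q`. -/
theorem measureReal_sub_le_of_homothety {U W : Set (Space d)} (p : Space d) {q : ℝ} (q1 : q ≤ 1)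
    (hW : volume W ≠ ∞) (h : ∀ x ∈ U, AffineMap.homothety p (1 - q) x ∈ W) :
    volume.real U - volume.real W ≤ d * q * volume.real U := by
  have h1 : volume.real (AffineMap.homothety p (1 - q) '' U) ≤ volume.real W :=
    measureReal_mono (image_subset_iff.2 h) hW
  rw [measureReal_def, Measure.addHaar_image_homothety, ENNReal.toReal_mul,
    ENNReal.toReal_ofReal (abs_nonneg _), finrank_euclideanSpace_fin,
    abs_of_nonneg (pow_nonneg (by linarith) _), ← measureReal_def] at h1
  have h2 : 1 + (d : ℝ) * (-q) ≤ (1 + -q) ^ d := one_add_mul_le_pow (by linarith) d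
  have h3 := mul_le_mul_of_nonneg_right h2 (measureReal_nonneg (μ := volume) (s := U))
  rw [← sub_eq_add_neg] at h3
  linarith

/-- The part of `A` strictly above the level `t` of the linear functional `⟪a, ·⟫`. -/
def above (A : Set (Space d)) (a : Space d) (t : ℝ) : Set (Space d) := A ∩ {x | t < inner ℝ a x}

theorem measurableSet_above {A : Set (Space d)} (hA : MeasurableSet A) (a : Space d) (t : ℝ) :
    MeasurableSet (above A a t) :=
  hA.inter (measurableSet_lt measurable_const (by fun_prop))

theorem above_subset (A : Set (Space d)) (a : Space d) (t : ℝ) : above A a t ⊆ A :=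
  inter_subset_left

theorem above_anti (A : Set (Space d)) (a : Space d) : Antitone (above A a) := fun _ _ hst _ hx =>
  ⟨hx.1, lt_of_le_of_lt hst hx.2⟩

/-- The slab `t < ⟪a, x⟫ ≤ t + h`, with `h = 2 r / (3 d)`, contains at most half of the volume of a
convex body that contains a ball of radius `r`. The contraction towards a highest point bounds the
volume of the slab by a fraction `d h / (β - t)` of the volume above `t`, the contraction towards a
lowest point bounds it by a fraction `d h / (t + h - α)` of the volume below `t + h`, and the
height difference `β - α` of the two points is at least `2 r`. -/
theorem measureReal_slab_le (hd : 1 ≤ d) {A : Set (Space d)} (hA : IsCompact A)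
    (hconv : Convex ℝ A) {z : Space d} {r : ℝ} (hr : 0 < r) (hz : Metric.closedBall z r ⊆ A)
    {a : Space d} (ha : ‖a‖ = 1) (t : ℝ) :
    volume.real (above A a t) - volume.real (above A a (t + 2 * r / (3 * d))) ≤
      volume.real A / 2 := by
  have hd' : (0 : ℝ) < d := by exact_mod_cast hd
  set h := 2 * r / (3 * d) with hh
  have h0 : 0 < h := by positivity
  have dh : d * h = 2 * r / 3 := by rw [hh]; field_simp
  have hne : A.Nonempty := ⟨z, hz (Metric.mem_closedBall_self hr.le)⟩
  have hcont : ContinuousOn (fun x : Space d => (inner ℝ a x : ℝ)) A := by fun_prop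
  obtain ⟨p, hp, hpmax⟩ := hA.exists_isMaxOn hne hcont
  obtain ⟨y, hy, hymin⟩ := hA.exists_isMinOn hne hcont
  have hpmax : ∀ x ∈ A, (inner ℝ a x : ℝ) ≤ inner ℝ a p := fun x hx => hpmax hx
  have hymin : ∀ x ∈ A, (inner ℝ a y : ℝ) ≤ inner ℝ a x := fun x hx => hymin hx
  set β : ℝ := inner ℝ a p
  set α : ℝ := inner ℝ a y
  have haa : inner ℝ a a = (1 : ℝ) := by rw [real_inner_self_eq_norm_sq, ha]; norm_num
  have width : 2 * r ≤ β - α := by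
    have h1 := hpmax (z + r • a) (hz (by simp [norm_smul, ha, abs_of_pos hr]))
    have h2 := hymin (z - r • a) (hz (by simp [norm_smul, ha, abs_of_pos hr]))
    rw [inner_add_right, inner_smul_right, haa] at h1
    rw [inner_sub_right, inner_smul_right, haa] at h2
    linarith
  have fin : ∀ S, S ⊆ A → volume S ≠ ∞ := fun S hS => measure_ne_top_of_subset hS hA.measure_ne_top
  have hN1A : above A a t ⊆ A := above_subset A a t
  have hN2A : above A a (t + h) ⊆ A := above_subset A a _
  have sub21 : above A a (t + h) ⊆ above A a t := above_anti A a (by linarith)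
  have mono21 : volume.real (above A a (t + h)) ≤ volume.real (above A a t) :=
    measureReal_mono sub21 (fin _ hN1A)
  have e1 : volume.real (A \ above A a (t + h)) = volume.real A - volume.real (above A a (t + h)) :=
    measureReal_sdiff hN2A (measurableSet_above hA.measurableSet a _) hA.measure_ne_top
  have e2 : volume.real (A \ above A a t) = volume.real A - volume.real (above A a t) :=
    measureReal_sdiff hN1A (measurableSet_above hA.measurableSet a _) hA.measure_ne_top
  have N2 : 0 ≤ volume.real (above A a (t + h)) := measureReal_nonneg
  have N1V : volume.real (above A a t) ≤ volume.real A := measureReal_mono hN1A (fin _ subset_rfl)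
  have hmem : ∀ x ∈ A, ∀ w ∈ A, ∀ q : ℝ, 0 ≤ q → q ≤ 1 → AffineMap.homothety w (1 - q) x ∈ A := by
    intro x hx w hw q q0 q1
    have := hconv hx hw (a := 1 - q) (b := q) (by linarith) q0 (by ring)
    convert this using 1
    rw [AffineMap.homothety_apply]
    simp only [vsub_eq_sub, vadd_eq_add, smul_sub, sub_smul, one_smul]
    abel
  have hval : ∀ x w : Space d, ∀ q : ℝ, inner ℝ a (AffineMap.homothety w (1 - q) x) =
      (1 - q) * inner ℝ a x + q * inner ℝ a w := by
    intro x w q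
    rw [AffineMap.homothety_apply]
    simp only [vsub_eq_sub, vadd_eq_add, inner_add_right, inner_smul_right, inner_sub_right]
    ring
  set P := volume.real (above A a t) - volume.real (above A a (t + h)) with hP
  have top : P * (β - t) ≤ d * h * volume.real (above A a t) := by
    rcases le_or_gt (β - t) h with hle | hlt
    · have hd1 : (1 : ℝ) ≤ d := by exact_mod_cast hd
      have hP1 : P ≤ volume.real (above A a t) := by linarith
      have hN1 : 0 ≤ volume.real (above A a t) := measureReal_nonneg
      calc P * (β - t) ≤ P * h := mul_le_mul_of_nonneg_left hle (by linarith)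
        _ ≤ volume.real (above A a t) * h := mul_le_mul_of_nonneg_right hP1 h0.le
        _ ≤ d * (volume.real (above A a t) * h) := le_mul_of_one_le_left (by positivity) hd1
        _ = _ := by ring
    · have hpos : 0 < β - t := h0.trans hlt
      have hq1 : h / (β - t) < 1 := (div_lt_one hpos).2 hlt
      have hqe : h / (β - t) * (β - t) = h := div_mul_cancel₀ _ hpos.ne'
      set q := h / (β - t)
      have key := measureReal_sub_le_of_homothety (U := above A a t) (W := above A a (t + h)) p
        (q := q) hq1.le (fin _ hN2A) (by
          intro x hx
          refine ⟨hmem x hx.1 p hp _ (by positivity) hq1.le, ?_⟩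
          simp only [mem_ofPred_eq, hval]
          have hx2 : t < inner ℝ a x := hx.2
          have := mul_lt_mul_of_pos_left hx2 (sub_pos.2 hq1)
          linarith)
      calc P * (β - t) ≤ d * q * volume.real (above A a t) * (β - t) :=
            mul_le_mul_of_nonneg_right key hpos.le
        _ = d * (q * (β - t)) * volume.real (above A a t) := by ring
        _ = _ := by rw [hqe]
  have bot : P * (t + h - α) ≤ d * h * volume.real (A \ above A a (t + h)) := by
    have hPe : P = volume.real (A \ above A a (t + h)) - volume.real (A \ above A a t) := by
      rw [e1, e2]; ring
    rcases le_or_gt (t + h - α) h with hle | hlt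
    · have hd1 : (1 : ℝ) ≤ d := by exact_mod_cast hd
      have hN1 : 0 ≤ volume.real (A \ above A a (t + h)) := measureReal_nonneg
      have hP1 : P ≤ volume.real (A \ above A a (t + h)) := by linarith
      calc P * (t + h - α) ≤ P * h := mul_le_mul_of_nonneg_left hle (by linarith)
        _ ≤ volume.real (A \ above A a (t + h)) * h := mul_le_mul_of_nonneg_right hP1 h0.le
        _ ≤ d * (volume.real (A \ above A a (t + h)) * h) :=
            le_mul_of_one_le_left (by positivity) hd1
        _ = _ := by ring
    · have hpos : 0 < t + h - α := h0.trans hlt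
      have hq1 : h / (t + h - α) < 1 := (div_lt_one hpos).2 hlt
      have hqe : h / (t + h - α) * (t + h - α) = h := div_mul_cancel₀ _ hpos.ne'
      set q := h / (t + h - α)
      have key := measureReal_sub_le_of_homothety (U := A \ above A a (t + h))
        (W := A \ above A a t) y (q := q) hq1.le (fin _ sdiff_subset) (by
          intro x hx
          have hx2 : inner ℝ a x ≤ t + h := by
            by_contra! hcon
            exact hx.2 ⟨hx.1, hcon⟩
          refine ⟨hmem x hx.1 y hy _ (by positivity) hq1.le, fun hcon => ?_⟩
          have h3 := hcon.2
          simp only [mem_ofPred_eq, hval] at h3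
          have := mul_le_mul_of_nonneg_left hx2 (sub_pos.2 hq1).le
          linarith)
      rw [← hPe] at key
      calc P * (t + h - α) ≤ d * q * volume.real (A \ above A a (t + h)) * (t + h - α) :=
            mul_le_mul_of_nonneg_right key hpos.le
        _ = d * (q * (t + h - α)) * volume.real (A \ above A a (t + h)) := by ring
        _ = _ := by rw [hqe]
  rw [e1] at bot
  have hsum : P * (β - α + h) ≤ d * h * (volume.real A + P) := by
    have : d * h * (volume.real A + P) = d * h * volume.real (above A a t) +
      d * h * (volume.real A - volume.real (above A a (t + h))) := by rw [hP]; ring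
    linarith
  rw [dh] at hsum
  have h5 : P * (2 * r) ≤ P * (β - α + h) :=
    mul_le_mul_of_nonneg_left (by linarith) (by linarith)
  have h6 : (2 * r) * P ≤ r * volume.real A := by nlinarith
  nlinarith

/-- The volume above a level is a log-concave function of the level. -/
theorem measureReal_above_mul_le_sq {A : Set (Space d)} (hA : IsCompact A) (hconv : Convex ℝ A)
    (a : Space d) (t h : ℝ) :
    volume.real (above A a t) * volume.real (above A a (t + 2 * h)) ≤
      volume.real (above A a (t + h)) ^ 2 := by
  have fin : ∀ s, volume (above A a s) ≠ ∞ := fun s =>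
    measure_ne_top_of_subset inter_subset_left hA.measure_ne_top
  have key := volume_mul_volume_le_sq (measurableSet_above hA.measurableSet a t)
    (measurableSet_above hA.measurableSet a (t + 2 * h))
    (measurableSet_above hA.measurableSet a (t + h)) (by
      intro x hx y hy
      refine ⟨hconv.midpoint_mem hx.1 hy.1, ?_⟩
      have h1 := hx.2
      have h2 := hy.2
      simp only [mem_ofPred_eq, midpoint_eq_smul_add, inner_smul_right, inner_add_right,
        invOf_eq_inv] at *
      linarith)
  rw [measureReal_def, measureReal_def, measureReal_def, ← ENNReal.toReal_mul,
    ← ENNReal.toReal_pow]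
  exact ENNReal.toReal_mono (ENNReal.pow_ne_top (fin _)) key

/-- The center of gravity balances every linear functional. -/
theorem setIntegral_inner_sub_centerOfGravity {A : Set (Space d)} (hA : IsCompact A)
    (h0 : volume A ≠ 0) (a : Space d) :
    ∫ x in A, (inner ℝ a x - inner ℝ a (centerOfGravity A) : ℝ) = 0 := by
  have hint : IntegrableOn (fun x : Space d => x) A :=
    continuous_id.continuousOn.integrableOn_compact hA
  have hV : volume.real A ≠ 0 := (measureReal_ne_zero_iff hA.measure_ne_top).2 h0
  rw [integral_sub (hint.const_inner a)
    (integrable_const_iff.2 (Or.inr ⟨by simpa using hA.measure_lt_top⟩)), setIntegral_const,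
    integral_inner hint, centerOfGravity, setAverage_eq, inner_smul_right, smul_eq_mul,
    mul_inv_cancel_left₀ hV, sub_self]

/-- A robust form of **Grünbaum's inequality**, with `δ = r / (6 d)`: at least the fraction `1 / 40`
of a convex body that contains a ball of radius `r` lies more than `δ` above the center of gravity.

Otherwise let `j` be the least number such that more than `11 / 20` of the volume lies above the
level `-j δ` relative to the center of gravity; then `j ≥ 4`, by `measureReal_slab_le`.
Log-concavity makes the volume above the levels `-j δ + k (j + 1) δ` decay like `22 ^ (-k)`, so
that the part above the center of gravity is too small to balance the `9 / 20` of the volume that lie below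
`-(j - 1) δ`. -/
theorem measureReal_le_mul_above (hd : 1 ≤ d) {A : Set (Space d)} (hA : IsCompact A)
    (hconv : Convex ℝ A) {z : Space d} {r : ℝ} (hr : 0 < r) (hz : Metric.closedBall z r ⊆ A)
    {a : Space d} (ha : ‖a‖ = 1) :
    volume.real A ≤ 40 * volume.real
      (above A a (inner ℝ a (centerOfGravity A) + r / (6 * d))) := by
  have hd' : (0 : ℝ) < d := by exact_mod_cast hd
  set δ := r / (6 * d) with hδ
  have δ0 : 0 < δ := by positivity
  set τ : ℝ := inner ℝ a (centerOfGravity A) with hτ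
  set V := volume.real A with hV
  have V0' : volume A ≠ 0 := fun h =>
    (Metric.measure_closedBall_pos volume z hr).ne' (measure_mono_null hz h)
  have V0 : 0 < V := (measureReal_nonneg).lt_of_ne'
    ((measureReal_ne_zero_iff hA.measure_ne_top).2 V0')
  set m : ℝ → ℝ := fun s => volume.real (above A a (τ + s)) with hm
  have fin : ∀ s, volume (above A a s) ≠ ∞ := fun s =>
    measure_ne_top_of_subset inter_subset_left hA.measure_ne_top
  have m0 : ∀ s, 0 ≤ m s := fun s => measureReal_nonneg
  have manti : Antitone m := fun s t hst => measureReal_mono (above_anti A a (by linarith)) (fin _)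
  have mlog : ∀ s h, m s * m (s + 2 * h) ≤ m (s + h) ^ 2 := fun s h => by
    simpa only [hm, ← add_assoc] using measureReal_above_mul_le_sq hA hconv a (τ + s) h
  have mslab : m (-(3 * δ)) - m δ ≤ V / 2 := by
    have := measureReal_slab_le hd hA hconv hr hz ha (τ + -(3 * δ))
    have e : τ + -(3 * δ) + 2 * r / (3 * d) = τ + δ := by rw [hδ]; field_simp; ring
    rwa [e] at this
  by_contra! hcon
  change 40 * m δ < V at hcon
  obtain ⟨B, hB⟩ : ∃ B : ℝ, ∀ x ∈ A, |(inner ℝ a x : ℝ) - τ| ≤ B := by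
    obtain ⟨B, hB⟩ := hA.exists_bound_of_continuousOn
      (f := fun x : Space d => (inner ℝ a x : ℝ) - τ)
      (by fun_prop)
    exact ⟨B, fun x hx => hB x hx⟩
  have hex : ∃ j : ℕ, 11 / 20 * V < m (-(j * δ)) := by
    obtain ⟨j, hj⟩ := exists_nat_gt (B / δ)
    refine ⟨j, ?_⟩
    have : above A a (τ + -(j * δ)) = A := by
      refine inter_eq_left.2 fun x hx => ?_
      have h1 := (abs_le.1 (hB x hx)).1
      rw [div_lt_iff₀ δ0] at hj
      simp only [mem_ofPred_eq]; linarith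
    simp only [hm, this]
    linarith
  classical
  set j := Nat.find hex with hj
  have hj1 : 11 / 20 * V < m (-(j * δ)) := Nat.find_spec hex
  have hj4 : 4 ≤ j := by
    by_contra! hlt
    have h3 : (j : ℝ) ≤ 3 := by exact_mod_cast Nat.lt_succ_iff.1 hlt
    have := manti (show -(3 * δ) ≤ -(j * δ) by nlinarith)
    linarith
  obtain ⟨i, hi⟩ : ∃ i, j = i + 1 := ⟨j - 1, by omega⟩
  have hi2 : m (-(i * δ)) ≤ 11 / 20 * V := not_lt.1 (Nat.find_min hex (m := i) (by omega))
  have hi3 : (3 : ℝ) ≤ i := by exact_mod_cast (by omega : 3 ≤ i)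
  have hji : (j : ℝ) = i + 1 := by rw [hi]; push_cast; ring
  set H := (i + 2) * δ with hH
  have H0 : 0 < H := by positivity
  set b : ℕ → ℝ := fun k => m (-(j * δ) + k * H) with hb
  have b1 : b 1 = m δ := by simp only [hb]; congr 1; rw [hji, hH]; push_cast; ring
  have bdecay : ∀ k, b (k + 1) ≤ b k / 22 := by
    intro k
    induction k with
    | zero =>
      have : b 0 = m (-(j * δ)) := by simp [hb]
      rw [zero_add, b1, this]; linarith
    | succ k ih =>
      have h1 := mlog (-(j * δ) + k * H) H
      have e1 : -(j * δ) + k * H + 2 * H = -(j * δ) + ((k + 1 + 1 : ℕ) : ℝ) * H := by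
        push_cast; ring
      have e2 : -(j * δ) + k * H + H = -(j * δ) + ((k + 1 : ℕ) : ℝ) * H := by push_cast; ring
      rw [e1, e2] at h1
      change b k * b (k + 1 + 1) ≤ b (k + 1) ^ 2 at h1
      have p0 : 0 ≤ b k := m0 _
      have p1 : 0 ≤ b (k + 1) := m0 _
      rcases p0.eq_or_lt with h0 | h0
      · have p2 : b (k + 1 + 1) ≤ b (k + 1) := manti (by push_cast; nlinarith)
        linarith
      · refine le_of_mul_le_mul_left (h1.trans ?_) h0
        nlinarith
  have bsum : ∀ N : ℕ, ∑ k ∈ Finset.range N, b (k + 1) ≤ 22 / 21 * (b 1 - b (N + 1)) := by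
    intro N
    induction N with
    | zero => simp
    | succ N ih =>
      rw [Finset.sum_range_succ]
      have := bdecay (N + 1)
      linarith
  obtain ⟨N, hN⟩ := exists_nat_gt (B / H)
  rw [div_lt_iff₀ H0] at hN
  set S := above A a (τ + -(i * δ)) with hS
  -- An upper bound for the linear functional by a step function.
  have pw : ∀ x ∈ A, (inner ℝ a x : ℝ) - τ ≤ (δ - i * δ) + i * δ * S.indicator 1 x +
      ∑ k ∈ Finset.range N, H * (above A a (τ + (δ + k * H))).indicator 1 x := by
    intro x hx
    by_cases hxS : x ∈ S
    · have step : ∀ M : ℕ, (inner ℝ a x : ℝ) - τ ≤ δ + M * H →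
          (inner ℝ a x : ℝ) - τ ≤ δ + ∑ k ∈ Finset.range M,
            H * (above A a (τ + (δ + k * H))).indicator (1 : Space d → ℝ) x := by
        intro M
        induction M with
        | zero => simp
        | succ M ih =>
          intro hM
          rcases le_or_gt ((inner ℝ a x : ℝ) - τ) (δ + M * H) with hle | hlt
          · have h0 : 0 ≤ H * (above A a (τ + (δ + M * H))).indicator (1 : Space d → ℝ) x :=
              mul_nonneg H0.le (indicator_nonneg (fun _ _ => zero_le_one) _)
            rw [Finset.sum_range_succ]
            linarith [ih hle]
          · have : ∀ k ∈ Finset.range (M + 1),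
                H * (above A a (τ + (δ + k * H))).indicator (1 : Space d → ℝ) x = H := by
              intro k hk
              have hkM : (k : ℝ) ≤ M := by exact_mod_cast Nat.lt_succ_iff.1 (Finset.mem_range.1 hk)
              have hmem : x ∈ above A a (τ + (δ + k * H)) := by
                refine ⟨hx, ?_⟩
                simp only [mem_ofPred_eq]
                have := mul_le_mul_of_nonneg_right hkM H0.le
                linarith
              rw [indicator_of_mem hmem]; simp
            rw [Finset.sum_congr rfl this]
            simpa using hM
      rw [indicator_of_mem hxS]
      have := step N (by have := (abs_le.1 (hB x hx)).2; linarith)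
      simp only [Pi.one_apply]; linarith
    · have hx2 : (inner ℝ a x : ℝ) ≤ τ + -(i * δ) := by
        by_contra! hlt
        exact hxS ⟨hx, hlt⟩
      rw [indicator_of_notMem hxS]
      have hnn : ∀ k ∈ Finset.range N,
          0 ≤ H * (above A a (τ + (δ + k * H))).indicator (1 : Space d → ℝ) x := fun k _ =>
        mul_nonneg H0.le (indicator_nonneg (fun _ _ => zero_le_one) _)
      have := Finset.sum_nonneg hnn
      linarith
  have hAm := hA.measurableSet
  have indInt : ∀ s, ∫ x in A, (above A a s).indicator (1 : Space d → ℝ) x =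
      volume.real (above A a s) := fun s => by
    rw [integral_indicator_one (measurableSet_above hAm a s), measureReal_restrict_apply
      (measurableSet_above hAm a s), inter_eq_left.2 (above_subset A a s)]
  have indI : ∀ s, IntegrableOn ((above A a s).indicator (1 : Space d → ℝ)) A := fun s =>
    (integrable_indicator_iff (measurableSet_above hAm a s)).2
      (integrableOn_const (measure_ne_top_of_subset inter_subset_left
        (by simpa using hA.measure_ne_top)))
  have hfinA : IsFiniteMeasure (volume.restrict A) := ⟨by simpa using hA.measure_lt_top⟩
  have I0 : IntegrableOn (fun x => (inner ℝ a x : ℝ) - τ) A :=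
    ContinuousOn.integrableOn_compact hA (by fun_prop)
  have I1 : IntegrableOn (fun x => i * δ * S.indicator (1 : Space d → ℝ) x) A :=
    (indI _).const_mul _
  have I2 : IntegrableOn (fun x => (δ - i * δ) + i * δ * S.indicator (1 : Space d → ℝ) x) A :=
    (integrable_const _).add I1
  have I3 : ∀ k ∈ Finset.range N, IntegrableOn
      (fun x => H * (above A a (τ + (δ + k * H))).indicator (1 : Space d → ℝ) x) A :=
    fun k _ => (indI _).const_mul _
  have hle := setIntegral_mono_on I0 (I2.add (integrable_finsetSum _ I3)) hAm pw
  rw [setIntegral_inner_sub_centerOfGravity hA V0'] at hle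
  simp only [Pi.add_apply] at hle
  rw [integral_add I2 (integrable_finsetSum _ I3), integral_add (integrable_const _) I1,
    integral_finsetSum _ I3, setIntegral_const, integral_const_mul, indInt] at hle
  simp only [integral_const_mul, indInt] at hle
  have e3 : ∑ k ∈ Finset.range N, H * volume.real (above A a (τ + (δ + k * H))) =
      H * ∑ k ∈ Finset.range N, b (k + 1) := by
    rw [Finset.mul_sum]
    refine Finset.sum_congr rfl fun k _ => ?_
    simp only [hb, hm]
    congr 4
    rw [hji, hH]; push_cast; ring
  rw [e3, smul_eq_mul] at hle
  change 0 ≤ V * (δ - i * δ) + i * δ * m (-(i * δ)) + _ at hle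
  have h7 := bsum N
  have h8 : 0 ≤ b (N + 1) := m0 _
  -- `22 / 21 * (1 / 40) < 1 / 38`
  have h9 : H * ∑ k ∈ Finset.range N, b (k + 1) ≤ H * (V / 38) :=
    mul_le_mul_of_nonneg_left (by linarith) H0.le
  have h10 : i * δ * m (-(i * δ)) ≤ i * δ * (11 / 20 * V) :=
    mul_le_mul_of_nonneg_left hi2 (by positivity)
  have h11 : 0 ≤ (V * δ) * (1 - i + 11 / 20 * i + (i + 2) / 38) := by
    rw [hH] at h9; nlinarith
  have h12 := nonneg_of_mul_nonneg_right h11 (by positivity)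
  linarith

/-- A halfspace that has a point within `r / (6 d)` of the center of gravity on its boundary or
outside of it leaves at most the fraction `39 / 40` of the volume. -/
theorem measureReal_inter_halfspace_le (hd : 1 ≤ d) {A : Set (Space d)} (hA : IsCompact A)
    (hconv : Convex ℝ A) {z : Space d} {r : ℝ} (hr : 0 < r) (hz : Metric.closedBall z r ⊆ A)
    {a u : Space d} {b : ℝ} (ha : a ≠ 0) (hb : b ≤ inner ℝ a u)
    (hu : ‖u - centerOfGravity A‖ ≤ r / (6 * d)) :
    volume.real (A ∩ halfspace a b) ≤ 39 / 40 * volume.real A := by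
  have na : 0 < ‖a‖ := norm_pos_iff.2 ha
  have h1 : ‖(‖a‖⁻¹ • a : Space d)‖ = 1 := by rw [norm_smul]; simp [na.ne']
  have h2 := measureReal_le_mul_above hd hA hconv hr hz h1
  set c := inner ℝ (‖a‖⁻¹ • a) (centerOfGravity A) + r / (6 * d) with hc
  have hm := measurableSet_above hA.measurableSet (‖a‖⁻¹ • a) c
  have hsub : A ∩ halfspace a b ⊆ A \ above A (‖a‖⁻¹ • a) c := by
    rintro x ⟨hx, hxb⟩
    refine ⟨hx, fun hcon => ?_⟩
    have h3 : c < inner ℝ (‖a‖⁻¹ • a) x := hcon.2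
    have h4 : inner ℝ a x ≤ b := hxb
    have h5 := (real_inner_le_norm (‖a‖⁻¹ • a) (u - centerOfGravity A))
    rw [h1, one_mul, inner_sub_right] at h5
    have h6 : inner ℝ (‖a‖⁻¹ • a) x ≤ (inner ℝ (‖a‖⁻¹ • a) u : ℝ) := by
      rw [real_inner_smul_left, real_inner_smul_left]
      exact mul_le_mul_of_nonneg_left (h4.trans hb) (inv_nonneg.2 na.le)
    linarith
  have h3 := measureReal_mono (μ := volume) hsub
    (measure_ne_top_of_subset sdiff_subset hA.measure_ne_top)
  rw [measureReal_sdiff (above_subset A _ _) hm hA.measure_ne_top] at h3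
  linarith

/-! ### Reflections in the boundary of a convex set -/

/-- `u` is the mirror image of `x` in the point of `C` nearest to `x`, that is, `u = 2 P x - x`
where `P` is the metric projection onto the convex set `C`. -/
def IsReflection (C : Set (Space d)) (x u : Space d) : Prop :=
  ∃ y ∈ C, u = y - (x - y) ∧ ∀ k ∈ C, inner ℝ (x - y) (k - y) ≤ (0 : ℝ)

/-- The reflection in a convex set is nonexpansive, because the projection is firmly
nonexpansive. -/
theorem IsReflection.dist_le {C : Set (Space d)} {x u x' u' : Space d} (h : IsReflection C x u)
    (h' : IsReflection C x' u') : dist u u' ≤ dist x x' := by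
  obtain ⟨y, hy, rfl, hk⟩ := h
  obtain ⟨y', hy', rfl, hk'⟩ := h'
  have h1 := hk y' hy'
  have h2 := hk' y hy
  rw [dist_eq_norm, dist_eq_norm]
  refine le_of_sq_le_sq ?_ (norm_nonneg _)
  have e1 : x - x' = (y - y') + ((x - y) - (x' - y')) := by abel
  have e2 : y - (x - y) - (y' - (x' - y')) = (y - y') - ((x - y) - (x' - y')) := by abel
  rw [e1, e2, norm_add_sq_real, norm_sub_sq_real]
  have e3 : inner ℝ (x - y) (y' - y) + inner ℝ (x' - y') (y - y') =
      -(inner ℝ (y - y') ((x - y) - (x' - y')) : ℝ) := by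
    rw [← neg_sub y y', inner_neg_right, real_inner_comm, real_inner_comm (y - y') (x' - y'),
      inner_sub_right (y - y') (x - y)]
    ring
  linarith

/-- Mirror images fill no more volume than the originals, because the reflection is nonexpansive
and the volume is a multiple of the Hausdorff measure. -/
theorem volume_le_of_isReflection {C E E' : Set (Space d)}
    (h : ∀ u ∈ E, ∃ x ∈ E', IsReflection C x u) : volume E ≤ volume E' := by
  choose! g hg hR using h
  have hinj : InjOn g E := fun u hu u' hu' he => by
    have := (hR u hu).dist_le (hR u' hu')
    rw [he, dist_self] at this
    exact dist_le_zero.1 this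
  have hinv : ∀ u ∈ E, Function.invFunOn g E (g u) = u := fun u hu => hinj.leftInvOn_invFunOn hu
  have hlip : LipschitzOnWith 1 (Function.invFunOn g E) (g '' E) := by
    refine LipschitzOnWith.of_dist_le_mul ?_
    rintro _ ⟨u, hu, rfl⟩ _ ⟨u', hu', rfl⟩
    rw [hinv u hu, hinv u' hu', NNReal.coe_one, one_mul]
    exact (hR u hu).dist_le (hR u' hu')
  have himg : Function.invFunOn g E '' (g '' E) = E := by
    rw [image_image]
    exact (image_congr fun u hu => hinv u hu).trans (image_id' E)
  have hH := hlip.hausdorffMeasure_image_le (d := Module.finrank ℝ (Space d)) (Nat.cast_nonneg _)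
  rw [himg, ENNReal.coe_one, ENNReal.one_rpow, one_mul] at hH
  have hinst : (μH[Module.finrank ℝ (Space d)] : Measure (Space d)).IsAddHaarMeasure :=
    isAddHaarMeasure_hausdorffMeasure
  rw [Measure.isAddLeftInvariant_eq_smul (volume : Measure (Space d))
    μH[Module.finrank ℝ (Space d)]]
  rw [Measure.smul_apply, Measure.smul_apply, ENNReal.smul_def, ENNReal.smul_def]
  exact mul_le_mul_right (hH.trans (measure_mono (image_subset_iff.2 hg))) _

/-- A point outside the interior of a convex set lies on a hyperplane that does not cut it. -/
theorem exists_inner_le_of_notMem_interior {C : Set (Space d)} (hC : Convex ℝ C)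
    (hne : (interior C).Nonempty) {q : Space d} (hq : q ∉ interior C) :
    ∃ m : Space d, m ≠ 0 ∧ ∀ k ∈ C, inner ℝ m k ≤ (inner ℝ m q : ℝ) := by
  obtain ⟨f, hf⟩ := geometric_hahn_banach_open_point hC.interior isOpen_interior hq
  set m := (InnerProductSpace.toDual ℝ (Space d)).symm f with hm
  have hfm : ∀ x, f x = inner ℝ m x := fun x => by
    rw [hm, InnerProductSpace.toDual_symm_apply]
  refine ⟨m, ?_, fun k hk => ?_⟩
  · intro h0
    obtain ⟨w, hw⟩ := hne
    have := hf w hw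
    rw [hfm, hfm, h0] at this
    simp at this
  · have hkc : k ∈ closure (interior C) := by
      rw [hC.closure_interior_eq_closure_of_nonempty_interior hne]
      exact subset_closure hk
    have hcl : IsClosed {x : Space d | (inner ℝ m x : ℝ) ≤ inner ℝ m q} :=
      isClosed_le (by fun_prop) continuous_const
    refine closure_minimal (fun x hx => ?_) hcl hkc
    have := hf x hx
    rw [hfm, hfm] at this
    exact this.le

/-- An obtuse angle at `y` with all points of `C` makes `y` a nearest point of `C`. -/
theorem infDist_eq_of_inner_le {C : Set (Space d)} {x y : Space d} (hy : y ∈ C)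
    (h : ∀ k ∈ C, inner ℝ (x - y) (k - y) ≤ (0 : ℝ)) : Metric.infDist x C = dist x y := by
  refine le_antisymm (Metric.infDist_le_dist_of_mem hy) ?_
  refine (Metric.le_infDist ⟨y, hy⟩).2 fun k hk => ?_
  rw [dist_eq_norm, dist_eq_norm]
  refine le_of_sq_le_sq ?_ (norm_nonneg _)
  have e : x - k = (x - y) - (k - y) := by abel
  rw [e, norm_sub_sq_real (x - y) (k - y)]
  nlinarith [h k hk, sq_nonneg ‖k - y‖]

theorem exists_nearest_point {C : Set (Space d)} (hC : Convex ℝ C) (hcl : IsClosed C)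
    (hne : C.Nonempty) (x : Space d) :
    ∃ y ∈ C, Metric.infDist x C = dist x y ∧ ∀ k ∈ C, inner ℝ (x - y) (k - y) ≤ (0 : ℝ) := by
  obtain ⟨y, hy, hd⟩ := hcl.exists_infDist_eq_dist hne x
  refine ⟨y, hy, hd, (norm_eq_iInf_iff_real_inner_le_zero hC hy).1 ?_⟩
  rw [← dist_eq_norm, ← hd, Metric.infDist_eq_iInf]
  simp_rw [dist_eq_norm]

/-- A point inside `C` at distance `≤ s` from the complement is the mirror image of a
point outside `C` at distance `≤ s` from `C`. -/
theorem exists_isReflection {C : Set (Space d)} (hC : Convex ℝ C) (hcl : IsClosed C)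
    {u q : Space d} (hu : u ∈ interior C) (hq : q ∉ interior C) :
    ∃ x, IsReflection C x u ∧ 0 < Metric.infDist x C ∧ Metric.infDist x C ≤ dist u q ∧
      dist x u ≤ 2 * dist u q := by
  -- the nearest point `y` to `u` outside of the interior
  obtain ⟨y, hy, hyd⟩ := (isOpen_interior (s := C)).isClosed_compl.exists_infDist_eq_dist ⟨q, hq⟩ u
  have hτ : dist u y ≤ dist u q := hyd ▸ Metric.infDist_le_dist_of_mem hq
  have huy : u ≠ y := fun h => hy (h ▸ hu)
  have τ0 : 0 < dist u y := dist_pos.2 huy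
  have hball : Metric.closedBall u (dist u y) ⊆ C := by
    rw [← closure_ball u τ0.ne']
    refine closure_minimal (fun w hw => interior_subset ?_) hcl
    by_contra hcon
    have := Metric.infDist_le_dist_of_mem (x := u) (s := (interior C)ᶜ) hcon
    rw [hyd] at this
    rw [Metric.mem_ball, dist_comm] at hw
    linarith
  have hyC : y ∈ C := hball (by simp [dist_comm])
  obtain ⟨m, m0, hm⟩ := exists_inner_le_of_notMem_interior hC ⟨u, hu⟩ hy
  have nm : 0 < ‖m‖ := norm_pos_iff.2 m0
  have hnorm : ‖y - u‖ = dist u y := by rw [dist_comm, dist_eq_norm]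
  -- the supporting hyperplane at `y` is orthogonal to `y - u`
  have hpar : ‖y - u‖ • m = ‖m‖ • (y - u) := by
    rw [← inner_eq_norm_mul_iff_real]
    refine le_antisymm (real_inner_le_norm _ _) ?_
    have h1 := hm (u + (dist u y / ‖m‖) • m) (hball (by
      simp [norm_smul, nm.ne', abs_of_pos τ0]))
    rw [inner_add_right, inner_smul_right, real_inner_self_eq_norm_sq] at h1
    rw [inner_sub_right, hnorm]
    have : dist u y / ‖m‖ * ‖m‖ ^ 2 = ‖m‖ * dist u y := by field_simp
    linarith
  have hobt : ∀ k ∈ C, inner ℝ (y - u) (k - y) ≤ (0 : ℝ) := by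
    intro k hk
    have h1 := hm k hk
    have h2 : ‖m‖ * inner ℝ (y - u) (k - y) = ‖y - u‖ * (inner ℝ m (k - y) : ℝ) := by
      rw [← real_inner_smul_left, ← hpar, real_inner_smul_left]
    have h3 : ‖y - u‖ * (inner ℝ m (k - y) : ℝ) ≤ 0 :=
      mul_nonpos_of_nonneg_of_nonpos (norm_nonneg _) (by rw [inner_sub_right]; linarith)
    exact nonpos_of_mul_nonpos_right (h2 ▸ h3) nm
  have hxy : y + (y - u) - y = y - u := by abel
  have hinf : Metric.infDist (y + (y - u)) C = dist u y := by
    rw [infDist_eq_of_inner_le hyC (by rwa [hxy]), dist_eq_norm, hxy, hnorm]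
  refine ⟨y + (y - u), ⟨y, hyC, by abel, by rwa [hxy]⟩, by rw [hinf]; exact τ0, by rwa [hinf], ?_⟩
  have : y + (y - u) - u = (2 : ℝ) • (y - u) := by rw [two_smul]; abel
  rw [dist_eq_norm, this, norm_smul, hnorm, Real.norm_ofNat]
  linarith

/-! ### The volume near the boundary of a convex set -/

theorem mem_cthickening_iff_infDist_le {C : Set (Space d)} (hne : C.Nonempty) {δ : ℝ} (hδ : 0 ≤ δ)
    {x : Space d} : x ∈ Metric.cthickening δ C ↔ Metric.infDist x C ≤ δ := by
  rw [Metric.mem_cthickening_iff, Metric.infDist]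
  exact ENNReal.le_ofReal_iff_toReal_le (Metric.infEDist_ne_top hne) hδ

/-- The points of the ball of radius `ρ` around `v` whose distance from `C` is strictly between
`t` and `t + σ`. -/
def shell (C : Set (Space d)) (v : Space d) (ρ t σ : ℝ) : Set (Space d) :=
  {x | t < Metric.infDist x C ∧ Metric.infDist x C < t + σ ∧ dist x v ≤ ρ}

theorem measurableSet_shell (C : Set (Space d)) (v : Space d) (ρ t σ : ℝ) :
    MeasurableSet (shell C v ρ t σ) := by
  have h1 : Measurable fun x => Metric.infDist x C := (Metric.continuous_infDist_pt C).measurable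
  have h2 : Measurable fun x : Space d => dist x v := by fun_prop
  exact (measurableSet_lt measurable_const h1).inter
    ((measurableSet_lt h1 measurable_const).inter (measurableSet_le h2 measurable_const))

/-- Reflection in the closed `(t + σ)`-neighbourhood of `C` maps a part of the next shell onto this
one, and moves points by less than `2 σ`. -/
theorem volume_shell_le {C : Set (Space d)} (hC : Convex ℝ C) (hcl : IsClosed C)
    (hne : C.Nonempty) (v : Space d) (ρ : ℝ) {t σ : ℝ} (ht : 0 ≤ t) (hσ : 0 < σ) :
    volume (shell C v ρ t σ) ≤ volume (shell C v (ρ + 2 * σ) (t + σ) σ) := by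
  have hts : 0 ≤ t + σ := by linarith
  refine volume_le_of_isReflection (C := Metric.cthickening (t + σ) C) ?_
  rintro u ⟨h1, h2, h3⟩
  obtain ⟨y, hy, hyd, hobt⟩ := exists_nearest_point hC hcl hne u
  have huI : u ∈ interior (Metric.cthickening (t + σ) C) :=
    Metric.thickening_subset_interior_cthickening _ _
      ((Metric.mem_thickening_iff_infDist_lt hne).2 h2)
  -- a point slightly outside the neighbourhood, on the ray from `y` through `u`
  set τ := Metric.infDist u C with hτ
  have τ0 : 0 < τ := lt_of_le_of_lt ht h1
  set w := (t + 2 * σ - τ) / 2 with hw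
  have w0 : 0 ≤ w := by rw [hw]; linarith
  set q := u + (w / τ) • (u - y) with hq
  have hn : ‖u - y‖ = τ := by rw [← dist_eq_norm, ← hyd]
  have hqy : q - y = (1 + w / τ) • (u - y) := by rw [hq, add_smul, one_smul]; abel
  have hc0 : 0 ≤ 1 + w / τ := by positivity
  have hqd : Metric.infDist q C = τ + w := by
    rw [infDist_eq_of_inner_le hy, dist_eq_norm, hqy, norm_smul, hn, Real.norm_of_nonneg hc0]
    · field_simp
    · intro k hk
      rw [hqy, real_inner_smul_left]
      exact mul_nonpos_of_nonneg_of_nonpos hc0 (hobt k hk)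
  have hqI : q ∉ interior (Metric.cthickening (t + σ) C) := fun hcon => by
    have := (mem_cthickening_iff_infDist_le hne hts).1 (interior_subset hcon)
    rw [hqd, hw] at this
    linarith
  have huq : dist u q = w := by
    rw [dist_comm, dist_eq_norm, hq, add_sub_cancel_left, norm_smul, hn,
      Real.norm_of_nonneg (by positivity)]
    field_simp
  obtain ⟨x, hx, hx0, hx1, hx2⟩ := exists_isReflection (hC.cthickening _)
    Metric.isClosed_cthickening huI hqI
  rw [huq] at hx1 hx2
  have hwσ : w < σ := by rw [hw]; linarith
  refine ⟨x, ⟨?_, ?_, ?_⟩, hx⟩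
  · by_contra! hcon
    have := Metric.infDist_zero_of_mem ((mem_cthickening_iff_infDist_le hne hts).2 hcon)
    linarith
  · obtain ⟨k, hk, hkd⟩ := (Metric.isClosed_cthickening (δ := t + σ)
      (E := C)).exists_infDist_eq_dist
      ⟨u, interior_subset huI⟩ x
    have h5 := (mem_cthickening_iff_infDist_le hne hts).1 hk
    have h6 := Metric.infDist_le_infDist_add_dist (s := C) (x := x) (y := k)
    linarith
  · have := dist_triangle x u v
    linarith

/-- The volume of the points of `K` in a ball of radius `ρ` that have a point outside `K` within
distance `ρ / d ^ 2` is at most the fraction `e ^ 4 / d` of the volume of the ball: reflections in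
the boundary and in the boundaries of neighbourhoods of `K` embed copies of this set into
`d` disjoint shells, all of them contained in a ball of radius `(1 + 4 / d) ρ`. -/
theorem mul_measureReal_near_boundary_le (hd : 1 ≤ d) {K : Set (Space d)} (hK : Convex ℝ K)
    (hne : (interior K).Nonempty) (v : Space d) {ρ : ℝ} (hρ : 0 < ρ) :
    d * volume.real {u | u ∈ K ∧ dist u v ≤ ρ ∧ ∃ q, q ∉ K ∧ dist u q ≤ ρ / d ^ 2} ≤
      Real.exp 4 * volume.real (Metric.closedBall v ρ) := by
  have hd' : (0 : ℝ) < d := by exact_mod_cast hd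
  set C := closure K with hCdef
  have hC : Convex ℝ C := hK.closure
  have hcl : IsClosed C := isClosed_closure
  have hCne : C.Nonempty := (hne.mono interior_subset).closure
  have hint : interior C = interior K := hK.interior_closure_eq_interior_of_nonempty_interior hne
  set σ := 2 * (ρ / d ^ 2) with hσ
  have σ0 : 0 < σ := by positivity
  set bad := {u | u ∈ K ∧ dist u v ≤ ρ ∧ ∃ q, q ∉ K ∧ dist u q ≤ ρ / d ^ 2} with hbad
  have h0 : volume bad ≤ volume (shell C v (ρ + 2 * σ * 1) (σ * 0) σ) := by
    have hsplit : bad ⊆ (bad ∩ interior C) ∪ frontier K := by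
      intro u hu
      by_cases hui : u ∈ interior C
      · exact Or.inl ⟨hu, hui⟩
      · exact Or.inr ⟨subset_closure hu.1, hint ▸ hui⟩
    refine (measure_mono hsplit).trans ((measure_union_le _ _).trans ?_)
    rw [hK.addHaar_frontier volume, add_zero]
    refine volume_le_of_isReflection (C := C) ?_
    rintro u ⟨⟨hu1, hu2, q, hq, hqd⟩, hui⟩
    obtain ⟨x, hx, hx0, hx1, hx2⟩ := exists_isReflection hC hcl hui
      (q := q) (by rw [hint]; exact fun h => hq (interior_subset h))
    have hs : 0 < ρ / (d : ℝ) ^ 2 := by positivity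
    refine ⟨x, ⟨by linarith, by linarith, ?_⟩, hx⟩
    have := dist_triangle x u v
    linarith
  have hj : ∀ j : ℕ, volume bad ≤ volume (shell C v (ρ + 2 * σ * (j + 1)) (σ * j) σ) := by
    intro j
    induction j with
    | zero => simpa using h0
    | succ j ih =>
      refine ih.trans ((volume_shell_le hC hcl hCne v _ (by positivity) σ0).trans_eq ?_)
      congr 2 <;> push_cast <;> ring
  have hdisj : Pairwise (Function.onFun Disjoint
      fun j : ℕ => shell C v (ρ + 2 * σ * (j + 1)) (σ * j) σ) := by
    have key : ∀ i j : ℕ, i < j → Disjoint (shell C v (ρ + 2 * σ * (i + 1)) (σ * i) σ)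
        (shell C v (ρ + 2 * σ * (j + 1)) (σ * j) σ) := by
      intro i j hij
      rw [Set.disjoint_left]
      rintro x ⟨-, h2, -⟩ ⟨h1, -, -⟩
      have : (i : ℝ) + 1 ≤ j := by exact_mod_cast hij
      nlinarith
    intro i j hij
    rcases lt_or_gt_of_ne hij with h | h
    · exact key i j h
    · exact (key j i h).symm
  have hsum : (d : ℝ≥0∞) * volume bad ≤ volume (Metric.closedBall v (ρ * (1 + 4 / d))) := by
    calc (d : ℝ≥0∞) * volume bad = ∑ j ∈ Finset.range d, volume bad := by simp
      _ ≤ ∑ j ∈ Finset.range d, volume (shell C v (ρ + 2 * σ * (j + 1)) (σ * j) σ) :=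
          Finset.sum_le_sum fun j _ => hj j
      _ = volume (⋃ j ∈ Finset.range d, shell C v (ρ + 2 * σ * (j + 1)) (σ * j) σ) :=
          (measure_biUnion_finset (fun i _ j _ hij => hdisj hij)
            fun j _ => measurableSet_shell _ _ _ _ _).symm
      _ ≤ _ := by
          refine measure_mono (iUnion₂_subset fun j hjd x hx => ?_)
          have h1 : (j : ℝ) + 1 ≤ d := by exact_mod_cast Finset.mem_range.1 hjd
          have h2 : 2 * σ * (j + 1) ≤ 2 * σ * d := by gcongr
          have h3 : ρ * (1 + 4 / d) = ρ + 2 * σ * d := by rw [hσ]; field_simp; ring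
          rw [Metric.mem_closedBall, h3]
          exact hx.2.2.trans (by linarith)
  have hreal := ENNReal.toReal_mono measure_closedBall_lt_top.ne hsum
  rw [ENNReal.toReal_mul, ENNReal.toReal_natCast, ← measureReal_def, ← measureReal_def,
    Measure.addHaar_real_closedBall _ _ (by positivity), finrank_euclideanSpace_fin] at hreal
  refine hreal.trans ?_
  rw [Measure.addHaar_real_closedBall _ v hρ.le, finrank_euclideanSpace_fin, mul_pow, ← mul_assoc,
    mul_comm (Real.exp 4)]
  refine mul_le_mul_of_nonneg_right ?_ measureReal_nonneg
  refine mul_le_mul_of_nonneg_left ?_ (by positivity)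
  calc (1 + 4 / (d : ℝ)) ^ d ≤ Real.exp (4 / d) ^ d :=
        pow_le_pow_left₀ (by positivity) (by rw [add_comm]; exact Real.add_one_le_exp _) d
    _ = Real.exp 4 := by rw [← Real.exp_nat_mul]; congr 1; field_simp

/-! ### The probability of a failed test -/

theorem mem_testPoints {u q : Space d} {δ : ℝ} : q ∈ testPoints u δ ↔
    ∃ i, q = u + δ • EuclideanSpace.single i (1 : ℝ) ∨
      q = u - δ • EuclideanSpace.single i (1 : ℝ) := by
  simp [testPoints]

theorem dist_of_mem_testPoints {u q : Space d} {δ : ℝ} (hδ : 0 ≤ δ) (hq : q ∈ testPoints u δ) :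
    dist u q = δ := by
  obtain ⟨i, rfl | rfl⟩ := mem_testPoints.1 hq
  · rw [dist_eq_norm]; simp [norm_smul, abs_of_nonneg hδ]
  · rw [dist_eq_norm]; simp [norm_smul, abs_of_nonneg hδ]

/-- The points of `K` that have a test point outside of `K`. -/
def failSet (K : Set (Space d)) (δ : ℝ) : Set (Space d) :=
  {u | u ∈ K ∧ ∃ q ∈ testPoints u δ, q ∉ K}

/-- Every ball of radius `ρ` contains a ball of radius `ρ / 8` that is disjoint from the set of
failure. If a point at distance at most `3 ρ / 4` from the center is not in `K`, there is one that
is disjoint from `K`. Otherwise there is one all of whose test points are in `K`; in dimension one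
it need not be near the center, because the test points are as far as `ρ` away. -/
theorem exists_ball_disjoint_failSet (hd : 1 ≤ d) {K : Set (Space d)} (hK : Convex ℝ K)
    {z v : Space d} {ρ : ℝ} (hρ : 0 < ρ) (hz : Metric.closedBall z (6 * d * ρ) ⊆ K) :
    ∃ c, dist c v ≤ 7 / 8 * ρ ∧
      ∀ u ∈ Metric.ball c (ρ / 8), u ∉ failSet K (ρ / d ^ 2) := by
  have hd' : (0 : ℝ) < d := by exact_mod_cast hd
  have hne : (interior K).Nonempty :=
    ⟨z, interior_mono hz (by
      rw [mem_interior_iff_mem_nhds]; exact Metric.closedBall_mem_nhds z (by positivity))⟩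
  by_cases hA : ∃ q, q ∉ K ∧ dist q v ≤ 3 / 4 * ρ
  · obtain ⟨q, hq, hqv⟩ := hA
    obtain ⟨m, m0, hm⟩ := exists_inner_le_of_notMem_interior hK hne
      (fun h => hq (interior_subset h))
    have nm : 0 < ‖m‖ := norm_pos_iff.2 m0
    refine ⟨q + (ρ / 8 / ‖m‖) • m, ?_, fun u hu hcon => ?_⟩
    · have h1 : dist (q + (ρ / 8 / ‖m‖) • m) q = ρ / 8 := by
        rw [dist_eq_norm, add_sub_cancel_left, norm_smul, Real.norm_of_nonneg (by positivity)]
        field_simp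
      have := dist_triangle (q + (ρ / 8 / ‖m‖) • m) q v
      linarith
    · have h1 := hm u hcon.1
      rw [Metric.mem_ball, dist_eq_norm] at hu
      have h2 := abs_le.1 (abs_real_inner_le_norm m (u - (q + (ρ / 8 / ‖m‖) • m)))
      rw [inner_sub_right, inner_add_right, inner_smul_right, real_inner_self_eq_norm_sq] at h2
      have h3 : ρ / 8 / ‖m‖ * ‖m‖ ^ 2 = ‖m‖ * (ρ / 8) := by field_simp
      have h4 := mul_lt_mul_of_pos_left hu nm
      linarith [h2.1]
  push Not at hA
  have hB : ∀ q, dist q v ≤ 3 / 4 * ρ → q ∈ K := fun q hq => by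
    by_contra hcon
    linarith [hA q hcon]
  rcases hd.eq_or_lt with h1 | h2
  · subst h1
    -- on the line, `K` also contains an endpoint of the long interval around `z`
    have hline : ∀ x y : Space 1, x = y + (x 0 - y 0) • EuclideanSpace.single 0 (1 : ℝ) := by
      intro x y
      ext i
      rw [Subsingleton.elim i 0]
      simp
    have hdist : ∀ x y : Space 1, dist x y = |x 0 - y 0| := by
      intro x y
      simp [EuclideanSpace.dist_eq, Real.dist_eq, Real.sqrt_sq_eq_abs]
    have hKc : ∀ x y w : Space 1, x ∈ K → y ∈ K → x 0 ≤ w 0 → w 0 ≤ y 0 → w ∈ K := by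
      intro x y w hx hy h1 h2
      rcases (h1.trans h2).eq_or_lt with h3 | h3
      · have : w = x := by rw [hline w x]; simp [show w 0 = x 0 by linarith]
        rwa [this]
      · have hpos : 0 < y 0 - x 0 := by linarith
        have h4 := hK hx hy (a := (y 0 - w 0) / (y 0 - x 0)) (b := (w 0 - x 0) / (y 0 - x 0))
          (div_nonneg (by linarith) hpos.le) (div_nonneg (by linarith) hpos.le)
          (by field_simp; ring)
        convert h4 using 1
        ext i
        rw [Subsingleton.elim i 0]
        simp only [PiLp.add_apply, PiLp.smul_apply, smul_eq_mul]
        field_simp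
        ring
    have htest : ∀ u q : Space 1, q ∈ testPoints u (ρ / ((1 : ℕ) : ℝ) ^ 2) →
        q 0 = u 0 + ρ ∨ q 0 = u 0 - ρ := by
      intro u q hq
      obtain ⟨i, rfl | rfl⟩ := mem_testPoints.1 hq
      · left; rw [Subsingleton.elim i 0]; simp
      · right; rw [Subsingleton.elim i 0]; simp
    have shift : ∀ (x : Space 1) (t : ℝ),
        (x + t • EuclideanSpace.single 0 (1 : ℝ) : Space 1) 0 = x 0 + t := by
      intro x t; simp
    have hend : ∀ t : ℝ, |t| ≤ 6 * ρ → z + t • EuclideanSpace.single 0 (1 : ℝ) ∈ K := by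
      intro t ht
      refine hz ?_
      rw [Metric.mem_closedBall, hdist, shift]
      simpa using ht
    have hnear : ∀ t : ℝ, |t| ≤ 3 / 4 * ρ → v + t • EuclideanSpace.single 0 (1 : ℝ) ∈ K := by
      intro t ht
      refine hB _ ?_
      rw [hdist, shift]
      simpa using ht
    rcases le_total (v 0) (z 0) with hvz | hvz
    · refine ⟨v + (5 / 8 * ρ) • EuclideanSpace.single 0 (1 : ℝ), ?_, ?_⟩
      · rw [hdist, shift, add_sub_cancel_left, abs_of_nonneg (by positivity)]; linarith
      · rintro u hu ⟨-, q, hq, hqK⟩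
        rw [Metric.mem_ball, hdist, shift, abs_lt] at hu
        refine hqK (hKc _ _ q (hnear (-(3 / 4 * ρ))
          (by rw [abs_neg, abs_of_nonneg (by positivity)]))
          (hend (6 * ρ) (by rw [abs_of_nonneg (by positivity)])) ?_ ?_)
        · rw [shift]; rcases htest u q hq with h | h <;> linarith
        · rw [shift]; rcases htest u q hq with h | h <;> linarith
    · refine ⟨v + (-(5 / 8 * ρ)) • EuclideanSpace.single 0 (1 : ℝ), ?_, ?_⟩
      · rw [hdist, shift, add_sub_cancel_left, abs_neg, abs_of_nonneg (by positivity)]; linarith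
      · rintro u hu ⟨-, q, hq, hqK⟩
        rw [Metric.mem_ball, hdist, shift, abs_lt] at hu
        refine hqK (hKc _ _ q (hend (-(6 * ρ)) (by rw [abs_neg, abs_of_nonneg (by positivity)]))
          (hnear (3 / 4 * ρ) (by rw [abs_of_nonneg (by positivity)])) ?_ ?_)
        · rw [shift]; rcases htest u q hq with h | h <;> linarith
        · rw [shift]; rcases htest u q hq with h | h <;> linarith
  · refine ⟨v, by rw [dist_self]; positivity, ?_⟩
    rintro u hu ⟨-, q, hq, hqK⟩
    refine hqK (hB q ?_)
    have h5 := dist_of_mem_testPoints (by positivity) hq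
    have h6 : ρ / (d : ℝ) ^ 2 ≤ ρ / 4 := by
      have : (2 : ℝ) ≤ d := by exact_mod_cast h2
      gcongr
      nlinarith
    have h7 := dist_triangle_left q v u
    rw [Metric.mem_ball] at hu
    linarith

theorem measureReal_failSet_inter_le (hd : 1 ≤ d) {K : Set (Space d)} (hK : Convex ℝ K)
    {z : Space d} (v : Space d) {ρ : ℝ} (hρ : 0 < ρ) (hz : Metric.closedBall z (6 * d * ρ) ⊆ K) :
    volume.real (failSet K (ρ / d ^ 2) ∩ Metric.closedBall v ρ) ≤
      (1 - (1 / 8) ^ d) * volume.real (Metric.closedBall v ρ) := by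
  obtain ⟨c, hc, hcd⟩ := exists_ball_disjoint_failSet hd hK (v := v) hρ hz
  have hsub : Metric.ball c (ρ / 8) ⊆ Metric.closedBall v ρ := fun x hx => by
    rw [Metric.mem_ball] at hx
    rw [Metric.mem_closedBall]
    linarith [dist_triangle x c v]
  have h1 : volume.real (failSet K (ρ / d ^ 2) ∩ Metric.closedBall v ρ) ≤
      volume.real (Metric.closedBall v ρ \ Metric.ball c (ρ / 8)) :=
    measureReal_mono (fun x hx => ⟨hx.2, fun hxc => hcd x hxc hx.1⟩)
      (measure_ne_top_of_subset sdiff_subset measure_closedBall_lt_top.ne)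
  rw [measureReal_sdiff hsub Metric.isOpen_ball.measurableSet measure_closedBall_lt_top.ne] at h1
  have h2 : volume.real (Metric.ball c (ρ / 8)) =
      (1 / 8) ^ d * volume.real (Metric.closedBall v ρ) := by
    rw [Measure.addHaar_real_closedBall _ _ hρ.le, measureReal_def,
      Measure.addHaar_ball_of_pos _ _ (by positivity), ENNReal.toReal_mul,
      ENNReal.toReal_ofReal (by positivity), finrank_euclideanSpace_fin, ← measureReal_def,
      div_pow, div_pow]
    ring
  linarith

/-- The law of a single displacement. -/
noncomputable def stepLaw (d : ℕ) (r : ℝ) : Measure (Space d) :=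
  cond volume (Metric.closedBall (0 : Space d) (r / (6 * d)))

theorem isProbabilityMeasure_stepLaw (hd : 1 ≤ d) {r : ℝ} (hr : 0 < r) :
    IsProbabilityMeasure (stepLaw d r) := by
  have hd' : (0 : ℝ) < d := by exact_mod_cast hd
  exact cond_isProbabilityMeasure_of_finite
    (Metric.measure_closedBall_pos volume _ (by positivity)).ne' measure_closedBall_lt_top.ne

theorem stepLaw_absolutelyContinuous (d : ℕ) (r : ℝ) : stepLaw d r ≪ volume :=
  cond_absolutelyContinuous

theorem ae_stepLaw_norm_le (d : ℕ) (r : ℝ) : ∀ᵐ x ∂stepLaw d r, ‖x‖ ≤ r / (6 * d) := by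
  have h := ae_cond_mem (μ := (volume : Measure (Space d)))
    (s := Metric.closedBall (0 : Space d) (r / (6 * d))) measurableSet_closedBall
  filter_upwards [h] with x hx
  simpa using hx

theorem stepLaw_real_preimage_failSet (hd : 1 ≤ d) {r : ℝ} (hr : 0 < r) (K : Set (Space d))
    (v : Space d) : (stepLaw d r).real {ξ | v + ξ ∈ failSet K (r / (6 * d ^ 3))} *
      volume.real (Metric.closedBall v (r / (6 * d))) =
      volume.real (failSet K (r / (6 * d) / d ^ 2) ∩ Metric.closedBall v (r / (6 * d))) := by
  have hd' : (0 : ℝ) < d := by exact_mod_cast hd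
  have e : r / (6 * d) / (d : ℝ) ^ 2 = r / (6 * d ^ 3) := by field_simp
  have hpos : 0 < volume.real (Metric.closedBall v (r / (6 * d))) := by
    refine (measureReal_nonneg).lt_of_ne' ((measureReal_ne_zero_iff measure_closedBall_lt_top.ne).2
      (Metric.measure_closedBall_pos volume _ (by positivity)).ne')
  have e2 : volume.real (Metric.closedBall (0 : Space d) (r / (6 * d))) =
      volume.real (Metric.closedBall v (r / (6 * d))) := by
    rw [Measure.addHaar_real_closedBall_center _ v]
  rw [stepLaw, measureReal_def, cond_apply measurableSet_closedBall, ENNReal.toReal_mul,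
    ENNReal.toReal_inv, ← measureReal_def, ← measureReal_def, e2, mul_assoc, mul_comm, mul_assoc,
    mul_inv_cancel₀ hpos.ne', mul_one, e, measureReal_def, measureReal_def,
    ← measure_preimage_add volume v (failSet K _ ∩ _)]
  congr 2
  ext x
  simp only [mem_inter_iff, mem_ofPred_eq, mem_preimage, Metric.mem_closedBall, dist_eq_norm,
    add_sub_cancel_left, sub_zero]
  tauto

/-- The probability that the queried point lies in `K` but the test fails is at most `55 / d`, and
it is bounded away from `1`. -/
theorem stepLaw_failSet_le (hd : 1 ≤ d) {r : ℝ} (hr : 0 < r) {K : Set (Space d)}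
    (hK : Convex ℝ K) {z : Space d} (hz : Metric.closedBall z r ⊆ K) (v : Space d) :
    d * (stepLaw d r).real {ξ | v + ξ ∈ failSet K (r / (6 * d ^ 3))} ≤ 55 ∧
      (stepLaw d r).real {ξ | v + ξ ∈ failSet K (r / (6 * d ^ 3))} ≤ 1 - (1 / 8) ^ 110 := by
  have hd' : (0 : ℝ) < d := by exact_mod_cast hd
  have hρ : 0 < r / (6 * d) := by positivity
  have key := stepLaw_real_preimage_failSet hd hr K v
  have hpos : 0 < volume.real (Metric.closedBall v (r / (6 * d))) := by
    refine (measureReal_nonneg).lt_of_ne' ((measureReal_ne_zero_iff measure_closedBall_lt_top.ne).2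
      (Metric.measure_closedBall_pos volume _ (by positivity)).ne')
  have er : 6 * d * (r / (6 * d)) = r := by field_simp
  have h1 := measureReal_failSet_inter_le hd hK v hρ (z := z) (by rwa [er])
  have hne : (interior K).Nonempty :=
    ⟨z, interior_mono hz (by
      rw [mem_interior_iff_mem_nhds]; exact Metric.closedBall_mem_nhds z hr)⟩
  have h2 := mul_measureReal_near_boundary_le hd hK hne v hρ
  have h3 : volume.real (failSet K (r / (6 * d) / d ^ 2) ∩ Metric.closedBall v (r / (6 * d))) ≤
      volume.real {u | u ∈ K ∧ dist u v ≤ r / (6 * d) ∧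
        ∃ q, q ∉ K ∧ dist u q ≤ r / (6 * d) / d ^ 2} := by
    refine measureReal_mono ?_ (measure_ne_top_of_subset (fun x hx => hx.2.1)
      (measure_closedBall_lt_top (x := v) (r := r / (6 * d))).ne)
    rintro x ⟨⟨hxK, q, hq, hqK⟩, hxv⟩
    exact ⟨hxK, hxv, q, hqK, (dist_of_mem_testPoints (by positivity) hq).le⟩
  rw [← key] at h1 h3
  set p := (stepLaw d r).real {ξ | v + ξ ∈ failSet K (r / (6 * d ^ 3))}
  set V := volume.real (Metric.closedBall v (r / (6 * d)))
  have hp1 : p ≤ 1 - (1 / 8) ^ d := le_of_mul_le_mul_right h1 hpos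
  have hexp : Real.exp 4 ≤ 55 := by
    have := Real.exp_one_lt_d9
    have h4 : Real.exp 4 = Real.exp 1 ^ 4 := by rw [← Real.exp_nat_mul]; norm_num
    rw [h4]
    calc Real.exp 1 ^ 4 ≤ (2.7182818286 : ℝ) ^ 4 := by gcongr
      _ ≤ 55 := by norm_num
  have hp2 : d * p ≤ 55 := by
    have : d * p * V ≤ Real.exp 4 * V := by
      calc d * p * V = d * (p * V) := by ring
        _ ≤ _ := (mul_le_mul_of_nonneg_left h3 hd'.le).trans h2
    exact (le_of_mul_le_mul_right this hpos).trans hexp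
  refine ⟨hp2, ?_⟩
  rcases le_or_gt d 110 with hle | hlt
  · refine hp1.trans (sub_le_sub_left (pow_le_pow_of_le_one (by norm_num) (by norm_num) hle) _)
  · have h5 : (111 : ℝ) ≤ d := by exact_mod_cast hlt
    have h6 : p ≤ 1 / 2 := by
      by_contra! hcon
      nlinarith
    have h7 : (1 / 8 : ℝ) ^ 110 ≤ 1 / 2 := by
      calc (1 / 8 : ℝ) ^ 110 ≤ (1 / 8) ^ 1 :=
            pow_le_pow_of_le_one (by norm_num) (by norm_num) (by norm_num)
        _ ≤ 1 / 2 := by norm_num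
    linarith

/-! ### The steps of the algorithm -/

theorem OracleProg.run_map {Q A α β : Type} (O : Q → A) (f : α → β) (p : OracleProg Q A α) :
    (p.map f).run O = (f (p.run O).1, (p.run O).2) := by
  induction p with
  | pure x => rfl
  | ask q k ih => simp only [OracleProg.map, OracleProg.run, ih]

theorem run_checkAll (O : Space d → Answer d) (l : List (Space d)) (ok : Bool) :
    (checkAll l ok).run O = (ok && l.all fun q => (O q).isLeft, l.length) := by
  induction l generalizing ok with
  | nil => simp [checkAll, OracleProg.run]
  | cons q l ih => simp [checkAll, OracleProg.run, ih, Bool.and_assoc]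

theorem length_testPoints (u : Space d) (δ : ℝ) : (testPoints u δ).length = 2 * d := by
  simp [testPoints, List.length_flatMap, mul_comm]

/-- All test points around `u` are asserted to lie in the set. -/
def Passes (O : Space d → Answer d) (r : ℝ) (u : Space d) : Prop :=
  ∀ q ∈ testPoints u (r / (6 * (d : ℝ) ^ 3)), (O q).isLeft

theorem run_iteration_of_inr {O : Space d → Answer d} {r : ℝ} {A : Set (Space d)} {ξ a : Space d}
    {b : ℝ} (h : O (centerOfGravity A + ξ) = .inr (a, b)) :
    (iteration r A ξ).run O = (.inr (A ∩ halfspace a b), 1) := by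
  simp [iteration, OracleProg.run, h]

theorem run_iteration_of_passes {O : Space d → Answer d} {r : ℝ} {A : Set (Space d)} {ξ : Space d}
    (h : O (centerOfGravity A + ξ) = .inl ()) (hp : Passes O r (centerOfGravity A + ξ)) :
    (iteration r A ξ).run O = (.inl (centerOfGravity A + ξ), 2 * d + 1) := by
  have : ((testPoints (centerOfGravity A + ξ) (r / (6 * (d : ℝ) ^ 3))).all
      fun q => (O q).isLeft) = true := List.all_eq_true.2 hp
  simp only [iteration, OracleProg.run, h, OracleProg.run_map, run_checkAll, Bool.true_and,
    length_testPoints, this, if_true]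

theorem run_iteration_of_not_passes {O : Space d → Answer d} {r : ℝ} {A : Set (Space d)}
    {ξ : Space d} (h : O (centerOfGravity A + ξ) = .inl ())
    (hp : ¬ Passes O r (centerOfGravity A + ξ)) :
    (iteration r A ξ).run O = (.inr A, 2 * d + 1) := by
  have : ¬ ((testPoints (centerOfGravity A + ξ) (r / (6 * (d : ℝ) ^ 3))).all
      fun q => (O q).isLeft) = true := fun hc => hp (List.all_eq_true.1 hc)
  simp only [iteration, OracleProg.run, h, OracleProg.run_map, run_checkAll, Bool.true_and,
    length_testPoints, if_neg this]

variable (O : Space d → Answer d) (R r : ℝ)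

/-- The outer set after `n` iterations, or the empty set if the algorithm has returned. -/
noncomputable def outer (ξ : ℕ → Space d) (n : ℕ) : Set (Space d) :=
  Sum.elim (fun _ => ∅) id (loop O R r ξ n).1

/-- The number of oracle calls in the first `n` iterations. -/
noncomputable def calls (ξ : ℕ → Space d) (n : ℕ) : ℕ := (loop O R r ξ n).2

/-- The algorithm has returned after at most `n` iterations. -/
def Stopped (ξ : ℕ → Space d) (n : ℕ) : Prop := (loop O R r ξ n).1.isLeft

/-- The point that is queried at the start of iteration `n`. -/
noncomputable def query (ξ : ℕ → Space d) (n : ℕ) : Space d :=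
  centerOfGravity (outer O R r ξ n) + ξ n

variable {O R r}

theorem loop_eq_of_not_stopped {ξ : ℕ → Space d} {n : ℕ} (h : ¬ Stopped O R r ξ n) :
    loop O R r ξ n = (.inr (outer O R r ξ n), calls O R r ξ n) := by
  unfold Stopped at h
  unfold outer calls
  rcases hl : loop O R r ξ n with ⟨x | A, c⟩
  · simp [hl] at h
  · rfl

theorem loop_succ_of_stopped {ξ : ℕ → Space d} {n : ℕ} (h : Stopped O R r ξ n) :
    loop O R r ξ (n + 1) = loop O R r ξ n := by
  unfold Stopped at h
  rcases hl : loop O R r ξ n with ⟨x | A, c⟩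
  · simp [loop, hl]
  · simp [hl] at h

theorem loop_succ_of_not_stopped {ξ : ℕ → Space d} {n : ℕ} (h : ¬ Stopped O R r ξ n) :
    loop O R r ξ (n + 1) = (((iteration r (outer O R r ξ n) (ξ n)).run O).1,
      calls O R r ξ n + ((iteration r (outer O R r ξ n) (ξ n)).run O).2) := by
  rw [loop, loop_eq_of_not_stopped h]

theorem loop_succ_of_inr {ξ : ℕ → Space d} {n : ℕ} (h : ¬ Stopped O R r ξ n) {a : Space d} {b : ℝ}
    (hO : O (query O R r ξ n) = .inr (a, b)) :
    loop O R r ξ (n + 1) = (.inr (outer O R r ξ n ∩ halfspace a b), calls O R r ξ n + 1) := by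
  rw [loop_succ_of_not_stopped h, run_iteration_of_inr hO]

theorem loop_succ_of_passes {ξ : ℕ → Space d} {n : ℕ} (h : ¬ Stopped O R r ξ n)
    (hO : O (query O R r ξ n) = .inl ()) (hp : Passes O r (query O R r ξ n)) :
    loop O R r ξ (n + 1) = (.inl (query O R r ξ n), calls O R r ξ n + (2 * d + 1)) := by
  rw [loop_succ_of_not_stopped h, run_iteration_of_passes hO hp]
  rfl

theorem loop_succ_of_not_passes {ξ : ℕ → Space d} {n : ℕ} (h : ¬ Stopped O R r ξ n)
    (hO : O (query O R r ξ n) = .inl ()) (hp : ¬ Passes O r (query O R r ξ n)) :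
    loop O R r ξ (n + 1) = (.inr (outer O R r ξ n), calls O R r ξ n + (2 * d + 1)) := by
  rw [loop_succ_of_not_stopped h, run_iteration_of_not_passes hO hp]

/-- The first `n` iterations use only the displacements `ξ 0, …, ξ (n - 1)`. -/
theorem loop_update (ξ : ℕ → Space d) (x : Space d) {m n : ℕ} (h : m ≤ n) :
    loop O R r (Function.update ξ n x) m = loop O R r ξ m := by
  induction m with
  | zero => rfl
  | succ m ih =>
    have hm : Function.update ξ n x m = ξ m := Function.update_of_ne (by omega) _ _
    simp only [loop, ih (by omega), hm]

theorem IsSeparationOracle.isLeft_iff {K : Set (Space d)} (hO : IsSeparationOracle K O)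
    (u : Space d) : (O u).isLeft ↔ u ∈ K := by
  by_cases hu : u ∈ K
  · simp [(hO u).1 hu, hu]
  · obtain ⟨a, b, h, -⟩ := (hO u).2 hu
    simp [h, hu]

/-- The outer sets remain compact and convex, and contain `K`. -/
theorem IsSeparationOracle.outer_invariant {K : Set (Space d)} (hO : IsSeparationOracle K O)
    (hKR : K ⊆ Metric.closedBall 0 R) (ξ : ℕ → Space d) (n : ℕ)
    (h : ¬ Stopped O R r ξ n) :
    IsCompact (outer O R r ξ n) ∧ Convex ℝ (outer O R r ξ n) ∧ K ⊆ outer O R r ξ n := by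
  induction n with
  | zero => exact ⟨isCompact_closedBall 0 R, convex_closedBall 0 R, hKR⟩
  | succ n ih =>
    have hn : ¬ Stopped O R r ξ n := fun hs => h (by
      unfold Stopped at hs ⊢; rwa [loop_succ_of_stopped hs])
    obtain ⟨h1, h2, h3⟩ := ih hn
    by_cases hu : query O R r ξ n ∈ K
    · have hl := (hO _).1 hu
      by_cases hp : Passes O r (query O R r ξ n)
      · exact absurd (by unfold Stopped; rw [loop_succ_of_passes hn hl hp]; rfl) h
      · have : outer O R r ξ (n + 1) = outer O R r ξ n := by
          conv_lhs => unfold outer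
          rw [loop_succ_of_not_passes hn hl hp]; rfl
        rw [this]; exact ⟨h1, h2, h3⟩
    · obtain ⟨a, b, hl, -, hKH, -⟩ := (hO _).2 hu
      have : outer O R r ξ (n + 1) = outer O R r ξ n ∩ halfspace a b := by
        conv_lhs => unfold outer
        rw [loop_succ_of_inr hn hl]; rfl
      rw [this]
      have hcl : IsClosed (halfspace a b) := isClosed_le (by fun_prop) continuous_const
      have hcv : Convex ℝ (halfspace a b) := convex_halfSpace_le (f := fun x => inner ℝ a x)
        ⟨fun x y => inner_add_right a x y, fun c x => inner_smul_right a x c⟩ b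
      exact ⟨h1.inter_right hcl, h2.inter hcv, subset_inter h3 hKH⟩

/-- A returned point and all of the test points around it lie in `K`. -/
theorem IsSeparationOracle.mem_of_outputs {K : Set (Space d)} (hO : IsSeparationOracle K O)
    {ξ : ℕ → Space d} {x : Space d}
    (h : Outputs O R r ξ x) :
    x ∈ K ∧ ∀ q ∈ testPoints x (r / (6 * (d : ℝ) ^ 3)), q ∈ K := by
  obtain ⟨n, hn⟩ := h
  induction n with
  | zero => simp [loop] at hn
  | succ n ih =>
    by_cases hs : Stopped O R r ξ n
    · exact ih (by rwa [loop_succ_of_stopped hs] at hn)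
    by_cases hu : query O R r ξ n ∈ K
    · have hl := (hO _).1 hu
      by_cases hp : Passes O r (query O R r ξ n)
      · rw [loop_succ_of_passes hs hl hp] at hn
        obtain rfl : query O R r ξ n = x := by simpa using hn
        exact ⟨hu, fun q hq => (hO.isLeft_iff q).1 (hp q hq)⟩
      · rw [loop_succ_of_not_passes hs hl hp] at hn
        simp at hn
    · obtain ⟨a, b, hl, -⟩ := (hO _).2 hu
      rw [loop_succ_of_inr hs hl] at hn
      simp at hn

theorem monotone_calls (ξ : ℕ → Space d) : Monotone (calls O R r ξ) := by
  refine monotone_nat_of_le_succ fun n => ?_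
  by_cases hs : Stopped O R r ξ n
  · unfold calls; rw [loop_succ_of_stopped hs]
  · conv_rhs => unfold calls
    rw [loop_succ_of_not_stopped hs]
    exact Nat.le_add_right _ _

theorem le_calls_of_not_stopped {ξ : ℕ → Space d} {n : ℕ} (h : ¬ Stopped O R r ξ n) :
    n ≤ calls O R r ξ n := by
  induction n with
  | zero => exact Nat.zero_le _
  | succ n ih =>
    have hn : ¬ Stopped O R r ξ n := fun hs => h (by
      unfold Stopped at hs ⊢; rwa [loop_succ_of_stopped hs])
    have h1 : 1 ≤ ((iteration r (outer O R r ξ n) (ξ n)).run O).2 := by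
      simp [iteration, OracleProg.run]
    conv_rhs => unfold calls
    rw [loop_succ_of_not_stopped hn]
    have := ih hn
    simp only
    omega

/-- The cross-polytope spanned by the test points contains a ball. -/
theorem closedBall_subset_of_testPoints (hd : 1 ≤ d) {K : Set (Space d)} (hK : Convex ℝ K)
    {x : Space d} (hr : 0 < r) (hx : x ∈ K)
    (h : ∀ q ∈ testPoints x (r / (6 * (d : ℝ) ^ 3)), q ∈ K) :
    Metric.closedBall x (r / (6 * (d : ℝ) ^ (7 / 2 : ℝ))) ⊆ K := by
  have hd' : (0 : ℝ) < d := by exact_mod_cast hd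
  intro y hy
  set δ := r / (6 * (d : ℝ) ^ 3) with hδ
  have δ0 : 0 < δ := by positivity
  have hrad : r / (6 * (d : ℝ) ^ (7 / 2 : ℝ)) = δ / √d := by
    have : (d : ℝ) ^ (7 / 2 : ℝ) = d ^ 3 * √d := by
      rw [Real.sqrt_eq_rpow, ← Real.rpow_natCast, ← Real.rpow_add hd']; norm_num
    rw [this, hδ]; field_simp
  rw [hrad, Metric.mem_closedBall, dist_eq_norm] at hy
  set w := y - x with hw
  have hsqrt : 0 < √(d : ℝ) := Real.sqrt_pos.2 hd'
  have hsum : ∑ i, |w i| ≤ δ := by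
    have h1 : (∑ i, |w i|) ^ 2 ≤ d * ∑ i, |w i| ^ 2 := by
      simpa using sq_sum_le_card_mul_sum_sq (s := Finset.univ) (f := fun i => |w i|)
    have h2 : ∑ i, |w i| ^ 2 = ‖w‖ ^ 2 := by rw [EuclideanSpace.norm_sq_eq]; simp
    rw [h2] at h1
    have h3 : (d : ℝ) * ‖w‖ ^ 2 = (√d * ‖w‖) ^ 2 := by rw [mul_pow, Real.sq_sqrt hd'.le]
    rw [h3] at h1
    have h4 := le_of_sq_le_sq h1 (by positivity)
    rw [le_div_iff₀ hsqrt] at hy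
    linarith
  have hmem : ∀ i, x + (SignType.sign (w i) * δ : ℝ) • EuclideanSpace.single i (1 : ℝ) ∈ K := by
    intro i
    rcases lt_trichotomy (w i) 0 with hi | hi | hi
    · refine h _ (mem_testPoints.2 ⟨i, Or.inr ?_⟩)
      simp [sign_neg hi, sub_eq_add_neg]
    · simpa [hi] using hx
    · refine h _ (mem_testPoints.2 ⟨i, Or.inl ?_⟩)
      simp [sign_pos hi]
  have key := hK.sum_mem (t := Finset.univ)
    (w := fun o : Option (Fin d) => o.elim (1 - ∑ i, |w i| / δ) fun i => |w i| / δ)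
    (z := fun o => o.elim x fun i =>
      x + (SignType.sign (w i) * δ : ℝ) • EuclideanSpace.single i (1 : ℝ))
    (by
      rintro (_ | i) -
      · rw [← Finset.sum_div]
        simpa using (div_le_one δ0).2 hsum
      · exact div_nonneg (abs_nonneg _) δ0.le)
    (by simp [Fintype.sum_option])
    (by
      rintro (_ | i) -
      · exact hx
      · exact hmem i)
  convert key using 1
  rw [Fintype.sum_option]
  simp only [Option.elim, smul_add, Finset.sum_add_distrib, ← Finset.sum_smul, ← add_assoc,
    ← add_smul, sub_add_cancel, one_smul]
  have hyx : y = x + w := by rw [hw]; abel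
  rw [hyx]
  congr 1
  ext j
  rw [WithLp.ofLp_sum, Finset.sum_apply, Finset.sum_eq_single j]
  · have := sign_mul_abs (w j)
    simp only [PiLp.smul_apply, PiLp.single_apply, if_true, smul_eq_mul, mul_one]
    field_simp
    linarith
  · intro i _ hij
    simp [Ne.symm hij]
  · simp

/-! ### Measurability of the run of the algorithm -/

/-- Resampling one coordinate of an independent sequence does not change its law. -/
theorem measurePreserving_update {X : Type*} [MeasurableSpace X] (μ : ℕ → Measure X)
    [∀ n, IsProbabilityMeasure (μ n)] (n : ℕ) :
    MeasurePreserving (fun p : (ℕ → X) × X => Function.update p.1 n p.2)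
      ((Measure.infinitePi μ).prod (μ n)) (Measure.infinitePi μ) := by
  have hm : Measurable fun p : (ℕ → X) × X => Function.update p.1 n p.2 := by
    refine measurable_pi_lambda _ fun i => ?_
    by_cases hi : i = n
    · subst hi; simpa using measurable_snd
    · simp only [Function.update_of_ne hi]
      exact (measurable_pi_apply i).comp measurable_fst
  refine ⟨hm, Measure.eq_infinitePi μ fun s t ht => ?_⟩
  rw [Measure.map_apply hm (MeasurableSet.pi s.countable_toSet fun i _ => ht i)]
  have hpre : (fun p : (ℕ → X) × X => Function.update p.1 n p.2) ⁻¹' ((s : Set ℕ).pi t) =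
      (((s.erase n : Finset ℕ) : Set ℕ).pi t) ×ˢ (if n ∈ s then t n else univ) := by
    ext ⟨ξ, x⟩
    simp only [mem_preimage, mem_pi, mem_prod, Finset.mem_coe, Finset.mem_erase]
    constructor
    · intro h
      refine ⟨fun i hi => ?_, ?_⟩
      · simpa [Function.update_of_ne hi.1] using h i hi.2
      · split_ifs with hn
        · simpa using h n hn
        · trivial
    · rintro ⟨h1, h2⟩ i hi
      by_cases hin : i = n
      · subst hin; simpa [hi] using h2
      · simpa [Function.update_of_ne hin] using h1 i ⟨hin, hi⟩
  rw [hpre, Measure.prod_prod, Measure.infinitePi_pi μ fun i _ => ht i]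
  split_ifs with hn
  · rw [Finset.prod_erase_mul s (fun i => μ i (t i)) hn]
  · rw [measure_univ, mul_one, Finset.erase_eq_of_notMem hn]

theorem measurePreserving_update_displacementLaw (hd : 1 ≤ d) {r : ℝ} (hr : 0 < r) (n : ℕ) :
    MeasurePreserving (fun p : (ℕ → Space d) × Space d => Function.update p.1 n p.2)
      ((displacementLaw d r).prod (stepLaw d r)) (displacementLaw d r) := by
  have := isProbabilityMeasure_stepLaw hd hr
  exact measurePreserving_update (fun _ => stepLaw d r) n

theorem isProbabilityMeasure_displacementLaw (hd : 1 ≤ d) {r : ℝ} (hr : 0 < r) :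
    IsProbabilityMeasure (displacementLaw d r) := by
  have := isProbabilityMeasure_stepLaw hd hr
  exact inferInstanceAs (IsProbabilityMeasure (Measure.infinitePi fun _ => stepLaw d r))

/-- The volume and the center of gravity of the members of a family of sets depend measurably on
the parameter, if the graph of the family is measurable. -/
theorem aemeasurable_centerOfGravity {Ω : Type*} [MeasurableSpace Ω] {P : Measure Ω} [SFinite P]
    {S : Ω → Set (Space d)} (hS : ∀ ω, MeasurableSet (S ω))
    (hG : NullMeasurableSet {p : Ω × Space d | p.2 ∈ S p.1} (P.prod volume)) :
    AEMeasurable (fun ω => volume.real (S ω)) P ∧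
      AEMeasurable (fun ω => centerOfGravity (S ω)) P := by
  have h1 : AEMeasurable (fun ω => volume.real (S ω)) P := by
    have := (aemeasurable_const (b := (1 : ℝ≥0∞))).indicator₀ hG |>.lintegral_prod_right'
    refine AEMeasurable.ennreal_toReal (this.congr (ae_of_all _ fun ω => ?_))
    beta_reduce
    rw [← lintegral_indicator_one (hS ω)]
    rfl
  refine ⟨h1, ?_⟩
  have h2 : AEStronglyMeasurable (fun ω => ∫ x in S ω, x) P := by
    have hsnd : AEStronglyMeasurable (fun p : Ω × Space d => p.2) (P.prod volume) :=
      measurable_snd.aestronglyMeasurable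
    have := (hsnd.indicator₀ hG).integral_prod_right'
    refine this.congr (ae_of_all _ fun ω => ?_)
    beta_reduce
    rw [← integral_indicator (hS ω)]
    rfl
  have h3 : (fun ω => centerOfGravity (S ω)) =
      fun ω => (volume.real (S ω))⁻¹ • ∫ x in S ω, x := by
    funext ω
    rw [centerOfGravity, setAverage_eq]
  rw [h3]
  exact h1.inv.smul h2.aemeasurable

variable {K : Set (Space d)}

theorem measurableSet_outer (hO : IsSeparationOracle K O) (hKR : K ⊆ Metric.closedBall 0 R)
    (ξ : ℕ → Space d) (n : ℕ) : MeasurableSet (outer O R r ξ n) := by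
  by_cases hs : Stopped O R r ξ n
  · have : outer O R r ξ n = ∅ := by
      unfold Stopped at hs
      unfold outer
      rcases h : (loop O R r ξ n).1 with x | A
      · rfl
      · simp [h] at hs
    rw [this]; exact MeasurableSet.empty
  · exact (hO.outer_invariant hKR ξ n hs).1.measurableSet

theorem outer_update (ξ : ℕ → Space d) (x : Space d) (n : ℕ) :
    outer O R r (Function.update ξ n x) n = outer O R r ξ n := by
  unfold outer; rw [loop_update ξ x le_rfl]

theorem query_update (ξ : ℕ → Space d) (x : Space d) (n : ℕ) :
    query O R r (Function.update ξ n x) n = centerOfGravity (outer O R r ξ n) + x := by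
  unfold query; rw [outer_update, Function.update_self]

/-- The law of the queried point has a density, because the displacement is independent of the
center of gravity of the outer set. -/
theorem map_query_absolutelyContinuous (hd : 1 ≤ d) (hr : 0 < r) (n : ℕ)
    (hv : AEMeasurable (fun ξ => centerOfGravity (outer O R r ξ n)) (displacementLaw d r)) :
    AEMeasurable (fun ξ => query O R r ξ n) (displacementLaw d r) ∧
      (displacementLaw d r).map (fun ξ => query O R r ξ n) ≪ volume := by
  have hP := isProbabilityMeasure_displacementLaw hd hr
  have hμ := isProbabilityMeasure_stepLaw hd hr
  have hq : AEMeasurable (fun ξ => query O R r ξ n) (displacementLaw d r) :=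
    hv.add (measurable_pi_apply n).aemeasurable
  refine ⟨hq, Measure.AbsolutelyContinuous.mk fun N hN hN0 => ?_⟩
  rw [Measure.map_apply_of_aemeasurable hq hN,
    ← (measurePreserving_update_displacementLaw hd hr n).measure_preimage (hq.nullMeasurable hN)]
  have hae := Measure.quasiMeasurePreserving_fst (μ := displacementLaw d r)
    (ν := stepLaw d r) |>.ae_eq_comp hv.ae_eq_mk
  have hS : MeasurableSet {p : (ℕ → Space d) × Space d | hv.mk _ p.1 + p.2 ∈ N} :=
    ((hv.measurable_mk.comp measurable_fst).add measurable_snd) hN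
  have h0 : ((displacementLaw d r).prod (stepLaw d r))
      {p : (ℕ → Space d) × Space d | hv.mk _ p.1 + p.2 ∈ N} = 0 := by
    refine (Measure.measure_prod_null hS).2 (ae_of_all _ fun ξ => ?_)
    refine stepLaw_absolutelyContinuous d r ?_
    change volume ((fun x => hv.mk _ ξ + x) ⁻¹' N) = 0
    rw [measure_preimage_add, hN0]
  refine (measure_congr ?_).trans h0
  filter_upwards [hae] with p hp
  simp only [Function.comp_apply] at hp
  change (query O R r (Function.update p.1 n p.2) n ∈ N) = (hv.mk _ p.1 + p.2 ∈ N)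
  rw [query_update, hp]

theorem aemeasurable_answer (hd : 1 ≤ d) (hr : 0 < r) (hOm : AEMeasurable O volume) (n : ℕ)
    (hv : AEMeasurable (fun ξ => centerOfGravity (outer O R r ξ n)) (displacementLaw d r))
    (w : Space d) : AEMeasurable (fun ξ => O (query O R r ξ n + w)) (displacementLaw d r) := by
  obtain ⟨hq, hac⟩ := map_query_absolutelyContinuous hd hr n hv
  have h1 : AEMeasurable (fun u => O (u + w)) volume :=
    (hOm.mono_ac (by rw [map_add_right_eq_self])).comp_measurable (measurable_add_const w)
  exact (h1.mono_ac hac).comp_aemeasurable hq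

theorem measurable_isLeft {α β : Type*} [MeasurableSpace α] [MeasurableSpace β] :
    Measurable (Sum.isLeft : α ⊕ β → Bool) :=
  measurable_fun_sum (by exact measurable_const) (by exact measurable_const)

theorem nullMeasurableSet_passes (hd : 1 ≤ d) (hr : 0 < r) (hOm : AEMeasurable O volume) (n : ℕ)
    (hv : AEMeasurable (fun ξ => centerOfGravity (outer O R r ξ n)) (displacementLaw d r)) :
    NullMeasurableSet {ξ | Passes O r (query O R r ξ n)} (displacementLaw d r) := by
  have h1 : ∀ w, NullMeasurableSet {ξ | (O (query O R r ξ n + w)).isLeft} (displacementLaw d r) :=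
    fun w => (measurable_isLeft.comp_aemeasurable
      (aemeasurable_answer hd hr hOm n hv w)).nullMeasurable (measurableSet_singleton true)
  set δ := r / (6 * (d : ℝ) ^ 3) with hδ
  have h2 : {ξ | Passes O r (query O R r ξ n)} = ⋂ i : Fin d,
      ({ξ | (O (query O R r ξ n + δ • EuclideanSpace.single i (1 : ℝ))).isLeft} ∩
        {ξ | (O (query O R r ξ n + -(δ • EuclideanSpace.single i (1 : ℝ)))).isLeft}) := by
    ext ξ
    simp only [mem_ofPred_eq, mem_iInter, mem_inter_iff, Passes, mem_testPoints, ← sub_eq_add_neg]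
    constructor
    · intro h i
      exact ⟨h _ ⟨i, Or.inl rfl⟩, h _ ⟨i, Or.inr rfl⟩⟩
    · rintro h q ⟨i, rfl | rfl⟩
      exacts [(h i).1, (h i).2]
  rw [h2]
  exact NullMeasurableSet.iInter fun i => (h1 _).inter (h1 _)

theorem calls_succ (hO : IsSeparationOracle K O) (ξ : ℕ → Space d) (n : ℕ) :
    calls O R r ξ (n + 1) = calls O R r ξ n + {ξ | Stopped O R r ξ n}ᶜ.indicator
      (fun ξ => 1 + {ξ | (O (query O R r ξ n)).isLeft}.indicator (fun _ => 2 * d) ξ) ξ := by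
  by_cases hs : Stopped O R r ξ n
  · rw [indicator_of_notMem (by simpa using hs)]
    unfold calls; rw [loop_succ_of_stopped hs]; rfl
  · rw [indicator_of_mem (by simpa using hs)]
    by_cases hu : query O R r ξ n ∈ K
    · have hl := (hO _).1 hu
      rw [indicator_of_mem (by simp [hl])]
      conv_lhs => unfold calls
      by_cases hp : Passes O r (query O R r ξ n)
      · rw [loop_succ_of_passes hs hl hp, add_comm 1]
      · rw [loop_succ_of_not_passes hs hl hp, add_comm 1]
    · obtain ⟨a, b, hl, -⟩ := (hO _).2 hu
      rw [indicator_of_notMem (by simp [hl])]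
      conv_lhs => unfold calls
      rw [loop_succ_of_inr hs hl]; rfl

theorem stopped_succ_iff (hO : IsSeparationOracle K O) (ξ : ℕ → Space d) (n : ℕ) :
    Stopped O R r ξ (n + 1) ↔ Stopped O R r ξ n ∨
      ((O (query O R r ξ n)).isLeft ∧ Passes O r (query O R r ξ n)) := by
  by_cases hs : Stopped O R r ξ n
  · simp only [hs, true_or, iff_true]
    unfold Stopped at hs ⊢; rwa [loop_succ_of_stopped hs]
  · simp only [hs, false_or]
    by_cases hu : query O R r ξ n ∈ K
    · have hl := (hO _).1 hu
      by_cases hp : Passes O r (query O R r ξ n)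
      · simp [Stopped, loop_succ_of_passes hs hl hp, hl, hp]
      · simp [Stopped, loop_succ_of_not_passes hs hl hp, hp]
    · obtain ⟨a, b, hl, -⟩ := (hO _).2 hu
      simp [Stopped, loop_succ_of_inr hs hl, hl]

/-- The halfspace that is given by an answer of the oracle, or a dummy value if the answer is
an assertion of membership. -/
noncomputable def halfspaceData : Answer d → Space d × ℝ := Sum.elim (fun _ => (0, 0)) id

theorem measurable_halfspaceData : Measurable (halfspaceData (d := d)) :=
  measurable_fun_sum (by exact measurable_const) (by exact measurable_id)

theorem mem_outer_succ_iff (hO : IsSeparationOracle K O) (ξ : ℕ → Space d) (n : ℕ) (x : Space d) :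
    x ∈ outer O R r ξ (n + 1) ↔ x ∈ outer O R r ξ n ∧
      (((O (query O R r ξ n)).isLeft ∧ ¬ Passes O r (query O R r ξ n)) ∨
        (¬ (O (query O R r ξ n)).isLeft ∧ inner ℝ (halfspaceData (O (query O R r ξ n))).1 x ≤
          (halfspaceData (O (query O R r ξ n))).2)) := by
  by_cases hs : Stopped O R r ξ n
  · have h1 : outer O R r ξ n = ∅ := by
      unfold Stopped at hs
      unfold outer
      rcases h : (loop O R r ξ n).1 with x | A
      · rfl
      · simp [h] at hs
    have h2 : outer O R r ξ (n + 1) = ∅ := by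
      rw [← h1]; unfold outer; rw [loop_succ_of_stopped hs]
    simp [h1, h2]
  · by_cases hu : query O R r ξ n ∈ K
    · have hl := (hO _).1 hu
      by_cases hp : Passes O r (query O R r ξ n)
      · have : outer O R r ξ (n + 1) = ∅ := by
          conv_lhs => unfold outer
          rw [loop_succ_of_passes hs hl hp]; rfl
        simp [this, hl, hp]
      · have : outer O R r ξ (n + 1) = outer O R r ξ n := by
          conv_lhs => unfold outer
          rw [loop_succ_of_not_passes hs hl hp]; rfl
        simp [this, hl, hp]
    · obtain ⟨a, b, hl, -⟩ := (hO _).2 hu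
      have : outer O R r ξ (n + 1) = outer O R r ξ n ∩ halfspace a b := by
        conv_lhs => unfold outer
        rw [loop_succ_of_inr hs hl]; rfl
      simp [this, hl, halfspaceData, halfspace]

/-- All data of the state after `n` iterations are measurable functions of the displacements, up to
null sets. The outer set is represented by the graph of `ξ ↦ outer ξ n`. -/
theorem measurable_state (hd : 1 ≤ d) (hr : 0 < r) (hO : IsSeparationOracle K O)
    (hKR : K ⊆ Metric.closedBall 0 R) (hOm : AEMeasurable O volume) (n : ℕ) :
    NullMeasurableSet {ξ | Stopped O R r ξ n} (displacementLaw d r) ∧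
      AEMeasurable (fun ξ => calls O R r ξ n) (displacementLaw d r) ∧
      NullMeasurableSet {p : (ℕ → Space d) × Space d | p.2 ∈ outer O R r p.1 n}
        ((displacementLaw d r).prod volume) := by
  have hP := isProbabilityMeasure_displacementLaw hd hr
  induction n with
  | zero =>
    refine ⟨?_, ?_, ?_⟩
    · have : {ξ : ℕ → Space d | Stopped O R r ξ 0} = ∅ := by
        ext ξ; simp [Stopped, loop]
      rw [this]; exact MeasurableSet.empty.nullMeasurableSet
    · exact aemeasurable_const
    · exact (measurable_snd (measurableSet_closedBall (x := (0 : Space d))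
        (ε := R))).nullMeasurableSet
  | succ n ih =>
    obtain ⟨hS, hc, hG⟩ := ih
    have hv := (aemeasurable_centerOfGravity (fun ξ => measurableSet_outer hO hKR ξ n) hG).2
    have hA : AEMeasurable (fun ξ => O (query O R r ξ n)) (displacementLaw d r) := by
      simpa using aemeasurable_answer hd hr hOm n hv 0
    have hL : NullMeasurableSet {ξ | (O (query O R r ξ n)).isLeft} (displacementLaw d r) :=
      (measurable_isLeft.comp_aemeasurable hA).nullMeasurable (measurableSet_singleton true)
    have hp := nullMeasurableSet_passes hd hr hOm n hv
    refine ⟨?_, ?_, ?_⟩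
    · have : {ξ | Stopped O R r ξ (n + 1)} = {ξ | Stopped O R r ξ n} ∪
          ({ξ | (O (query O R r ξ n)).isLeft} ∩ {ξ | Passes O r (query O R r ξ n)}) := by
        ext ξ; exact stopped_succ_iff hO ξ n
      rw [this]
      exact hS.union (hL.inter hp)
    · simp_rw [calls_succ hO]
      exact hc.add ((aemeasurable_const.add (aemeasurable_const.indicator₀ hL)).indicator₀ hS.compl)
    · have hfst : ∀ {T : Set (ℕ → Space d)}, NullMeasurableSet T (displacementLaw d r) →
          NullMeasurableSet {p : (ℕ → Space d) × Space d | p.1 ∈ T}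
            ((displacementLaw d r).prod volume) := fun hT =>
        hT.preimage Measure.quasiMeasurePreserving_fst
      have hD : AEMeasurable (fun p : (ℕ → Space d) × Space d =>
          halfspaceData (O (query O R r p.1 n))) ((displacementLaw d r).prod volume) :=
        (measurable_halfspaceData.comp_aemeasurable hA).comp_quasiMeasurePreserving
          Measure.quasiMeasurePreserving_fst
      have hH : NullMeasurableSet {p : (ℕ → Space d) × Space d |
          inner ℝ (halfspaceData (O (query O R r p.1 n))).1 p.2 ≤
            (halfspaceData (O (query O R r p.1 n))).2} ((displacementLaw d r).prod volume) :=
        nullMeasurableSet_le ((measurable_fst.comp_aemeasurable hD).inner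
          measurable_snd.aemeasurable) (measurable_snd.comp_aemeasurable hD)
      have : {p : (ℕ → Space d) × Space d | p.2 ∈ outer O R r p.1 (n + 1)} =
          {p | p.2 ∈ outer O R r p.1 n} ∩
            (({p | p.1 ∈ {ξ | (O (query O R r ξ n)).isLeft}} ∩
              {p | p.1 ∈ {ξ | Passes O r (query O R r ξ n)}ᶜ}) ∪
            ({p | p.1 ∈ {ξ | (O (query O R r ξ n)).isLeft}ᶜ} ∩
              {p | inner ℝ (halfspaceData (O (query O R r p.1 n))).1 p.2 ≤
                (halfspaceData (O (query O R r p.1 n))).2})) := by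
        ext p; exact mem_outer_succ_iff hO p.1 n p.2
      rw [this]
      exact hG.inter (((hfst hL).inter (hfst hp.compl)).union ((hfst hL.compl).inter hH))

/-! ### The expected number of oracle calls -/

/-- A lower bound for the probability that an iteration makes progress, that is, either cuts the
outer set or returns. -/
noncomputable def progressBound : ℝ := (1 / 8) ^ 110

/-- The decrease of the potential in an iteration that makes progress. Apart from the test that
succeeds, an iteration makes at most `1 + 2 * 55 = 111` oracle calls in expectation, and it makes
progress with probability at least `progressBound`. -/
noncomputable def progressGain : ℝ := 111 / progressBound

theorem progressGain_pos : 0 < progressGain := by unfold progressGain progressBound; positivity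

/-- The potential of an outer set `A` relative to a ball of volume `V`: a bound for the expected
number of oracle calls that are still to come, namely `2 d` for the successful test, and
`progressGain` for the return and for each of the cuts that the volume of `A` leaves room for. -/
noncomputable def potential (V : ℝ) (A : Set (Space d)) : ℝ :=
  2 * d + progressGain + 40 * progressGain * Real.log (volume.real A / V)

theorem le_potential {V : ℝ} (hV : 0 < V) {A : Set (Space d)} (h : V ≤ volume.real A) :
    2 * d + progressGain ≤ potential V A := by
  have h1 : 0 ≤ Real.log (volume.real A / V) := Real.log_nonneg ((one_le_div hV).2 h)
  have := progressGain_pos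
  have h2 : 0 ≤ 40 * progressGain * Real.log (volume.real A / V) := by positivity
  unfold potential; linarith

theorem potential_cut_le {V : ℝ} (hV : 0 < V) {A B : Set (Space d)} (hB : 0 < volume.real B)
    (h : volume.real B ≤ 39 / 40 * volume.real A) :
    potential V B ≤ potential V A - progressGain := by
  have hA : 0 < volume.real A := by linarith
  have h1 : Real.log (volume.real B / V) ≤ Real.log (volume.real A / V) - 1 / 40 := by
    rw [Real.log_div hB.ne' hV.ne', Real.log_div hA.ne' hV.ne']
    have h2 := Real.log_le_log hB h
    rw [Real.log_mul (by norm_num) hA.ne'] at h2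
    have h3 := Real.log_le_sub_one_of_pos (show (0 : ℝ) < 39 / 40 by norm_num)
    linarith
  have h4 := mul_le_mul_of_nonneg_left h1 (show 0 ≤ 40 * progressGain by
    linarith [progressGain_pos])
  unfold potential
  linarith

/-- The number of oracle calls so far plus the potential of the current state. -/
noncomputable def energy (O : Space d → Answer d) (R r V : ℝ) (ξ : ℕ → Space d) (n : ℕ) : ℝ≥0∞ :=
  calls O R r ξ n + {ξ | Stopped O R r ξ n}ᶜ.indicator
    (fun ξ => ENNReal.ofReal (potential V (outer O R r ξ n))) ξ

theorem volume_real_closedBall_pos (z : Space d) (hr : 0 < r) :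
    0 < volume.real (Metric.closedBall z r) :=
  (measureReal_nonneg).lt_of_ne' ((measureReal_ne_zero_iff measure_closedBall_lt_top.ne).2
    (Metric.measure_closedBall_pos volume _ hr).ne')

theorem aemeasurable_energy (hd : 1 ≤ d) (hr : 0 < r) (hO : IsSeparationOracle K O)
    (hKR : K ⊆ Metric.closedBall 0 R) (hOm : AEMeasurable O volume) (V : ℝ) (n : ℕ) :
    AEMeasurable (fun ξ => energy O R r V ξ n) (displacementLaw d r) := by
  have hP := isProbabilityMeasure_displacementLaw hd hr
  obtain ⟨hS, hc, hG⟩ := measurable_state hd hr hO hKR hOm n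
  have hvol := (aemeasurable_centerOfGravity (fun ξ => measurableSet_outer hO hKR ξ n) hG).1
  have h1 : AEMeasurable (fun ξ => (calls O R r ξ n : ℝ≥0∞)) (displacementLaw d r) :=
    (measurable_from_top (f := fun k : ℕ => (k : ℝ≥0∞))).comp_aemeasurable hc
  refine h1.add (AEMeasurable.indicator₀ ?_ hS.compl)
  refine AEMeasurable.ennreal_ofReal ?_
  unfold potential
  exact aemeasurable_const.add ((Real.measurable_log.comp_aemeasurable
    (hvol.div_const V)).const_mul _)

/-- The effect of one iteration on the energy: it decreases by at least `progressGain - 1`, unless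
the queried point is in `K` but the test fails. -/
theorem energy_succ_le (hd : 1 ≤ d) (hr : 0 < r) (hO : IsSeparationOracle K O) {z : Space d}
    (hz : Metric.closedBall z r ⊆ K) (hKR : K ⊆ Metric.closedBall 0 R) {ξ : ℕ → Space d} {n : ℕ}
    (hs : ¬ Stopped O R r ξ n) (hξ : ‖ξ n‖ ≤ r / (6 * d)) :
    energy O R r (volume.real (Metric.closedBall z r)) ξ (n + 1) ≤
      ENNReal.ofReal (calls O R r ξ n + 1 +
        potential (volume.real (Metric.closedBall z r)) (outer O R r ξ n) - progressGain) +
      ENNReal.ofReal (progressGain + 2 * d) *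
        (failSet K (r / (6 * d ^ 3))).indicator 1 (query O R r ξ n) := by
  set V := volume.real (Metric.closedBall z r) with hVdef
  have hV : 0 < V := volume_real_closedBall_pos z hr
  obtain ⟨hc, hcv, hKo⟩ := hO.outer_invariant hKR ξ n hs
  have hVo : V ≤ volume.real (outer O R r ξ n) :=
    measureReal_mono (hz.trans hKo) hc.measure_ne_top
  have hpot := le_potential hV hVo
  have hgain := progressGain_pos
  have hreturn : ∀ {p : (Space d ⊕ Set (Space d)) × ℕ}, loop O R r ξ (n + 1) = p →
      p.1.isLeft → energy O R r V ξ (n + 1) = (p.2 : ℝ≥0∞) := by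
    rintro p rfl hp
    have : Stopped O R r ξ (n + 1) := hp
    rw [energy, indicator_of_notMem (by simpa using this), add_zero]
    rfl
  have hcont : ∀ {A : Set (Space d)} {c : ℕ}, loop O R r ξ (n + 1) = (.inr A, c) →
      0 ≤ potential V A → energy O R r V ξ (n + 1) = ENNReal.ofReal (c + potential V A) := by
    intro A c h hA
    have h1 : ¬ Stopped O R r ξ (n + 1) := by simp [Stopped, h]
    rw [energy, indicator_of_mem (by simpa using h1), ENNReal.ofReal_add (Nat.cast_nonneg _) hA,
      ENNReal.ofReal_natCast]
    simp [calls, outer, h]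
  by_cases hu : query O R r ξ n ∈ K
  · have hl := (hO _).1 hu
    by_cases hp : Passes O r (query O R r ξ n)
    · rw [hreturn (loop_succ_of_passes hs hl hp) rfl]
      refine le_trans ?_ le_self_add
      rw [← ENNReal.ofReal_natCast]
      refine ENNReal.ofReal_le_ofReal ?_
      push_cast
      linarith
    · have hfail : query O R r ξ n ∈ failSet K (r / (6 * d ^ 3)) := by
        refine ⟨hu, ?_⟩
        by_contra! hcon
        exact hp fun q hq => (hO.isLeft_iff q).2 (hcon q hq)
      rw [hcont (loop_succ_of_not_passes hs hl hp) (by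
        linarith [(Nat.cast_nonneg d : (0 : ℝ) ≤ d)]), indicator_of_mem hfail, Pi.one_apply,
        mul_one, ← ENNReal.ofReal_add (by
          linarith [(Nat.cast_nonneg d : (0 : ℝ) ≤ d),
            (Nat.cast_nonneg (calls O R r ξ n) : (0 : ℝ) ≤ _)]) (by positivity)]
      refine ENNReal.ofReal_le_ofReal ?_
      push_cast
      linarith
  · obtain ⟨a, b, hl, ha, hKH, hab⟩ := (hO _).2 hu
    have hcut := measureReal_inter_halfspace_le hd hc hcv hr (hz.trans hKo) ha hab (by
      simpa [query] using hξ)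
    have hVc : V ≤ volume.real (outer O R r ξ n ∩ halfspace a b) :=
      measureReal_mono (hz.trans (subset_inter hKo hKH))
        (measure_ne_top_of_subset inter_subset_left hc.measure_ne_top)
    have h1 := potential_cut_le hV (hV.trans_le hVc) hcut
    have h2 := le_potential hV hVc
    rw [hcont (loop_succ_of_inr hs hl) (by linarith [(Nat.cast_nonneg d : (0 : ℝ) ≤ d)])]
    refine le_trans ?_ le_self_add
    refine ENNReal.ofReal_le_ofReal ?_
    push_cast
    linarith

/-- The energy is a supermartingale. -/
theorem lintegral_energy_succ_le (hd : 1 ≤ d) (hr : 0 < r) (hK : Convex ℝ K)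
    (hO : IsSeparationOracle K O) {z : Space d} (hz : Metric.closedBall z r ⊆ K)
    (hKR : K ⊆ Metric.closedBall 0 R) (hOm : AEMeasurable O volume) (n : ℕ) :
    ∫⁻ ξ, energy O R r (volume.real (Metric.closedBall z r)) ξ (n + 1) ∂displacementLaw d r ≤
      ∫⁻ ξ, energy O R r (volume.real (Metric.closedBall z r)) ξ n ∂displacementLaw d r := by
  have hP := isProbabilityMeasure_displacementLaw hd hr
  have hμ := isProbabilityMeasure_stepLaw hd hr
  set V := volume.real (Metric.closedBall z r) with hVdef
  have hV : 0 < V := volume_real_closedBall_pos z hr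
  have hmp := measurePreserving_update_displacementLaw hd hr n
  have hm := aemeasurable_energy hd hr hO hKR hOm V (n + 1)
  rw [← hmp.map_eq] at hm
  conv_lhs => rw [← hmp.map_eq]
  rw [lintegral_map' hm hmp.measurable.aemeasurable,
    lintegral_prod (fun p : (ℕ → Space d) × Space d =>
      energy O R r V (Function.update p.1 n p.2) (n + 1)) (hm.comp_measurable hmp.measurable)]
  refine lintegral_mono fun ξ => ?_
  have hst : ∀ x, Stopped O R r (Function.update ξ n x) n ↔ Stopped O R r ξ n := fun x => by
    unfold Stopped; rw [loop_update ξ x le_rfl]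
  have hcalls : ∀ x, calls O R r (Function.update ξ n x) n = calls O R r ξ n := fun x => by
    unfold calls; rw [loop_update ξ x le_rfl]
  by_cases hs : Stopped O R r ξ n
  · have : ∀ x, energy O R r V (Function.update ξ n x) (n + 1) = energy O R r V ξ n := by
      intro x
      have h1 := (hst x).2 hs
      have h2 : Stopped O R r (Function.update ξ n x) (n + 1) :=
        (stopped_succ_iff hO _ n).2 (Or.inl h1)
      rw [energy, energy, indicator_of_notMem (by simpa using h2),
        indicator_of_notMem (by simpa using hs)]
      have h3 : calls O R r (Function.update ξ n x) (n + 1) = calls O R r ξ n := by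
        unfold calls; rw [loop_succ_of_stopped h1, loop_update ξ x le_rfl]
      rw [h3]
    simp [this]
  · obtain ⟨hc, hcv, hKo⟩ := hO.outer_invariant hKR ξ n hs
    have hVo : V ≤ volume.real (outer O R r ξ n) :=
      measureReal_mono (hz.trans hKo) hc.measure_ne_top
    have hpot := le_potential hV hVo
    have hgain := progressGain_pos
    have hd0 : (0 : ℝ) ≤ d := Nat.cast_nonneg d
    have hc0 : (0 : ℝ) ≤ calls O R r ξ n := Nat.cast_nonneg _
    set v := centerOfGravity (outer O R r ξ n) with hv
    set F := {x : Space d | v + x ∈ failSet K (r / (6 * d ^ 3))} with hF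
    set pot := potential V (outer O R r ξ n) with hpotdef
    set c : ℝ := (calls O R r ξ n : ℝ) with hcdef
    have hbound : ∀ᵐ x ∂stepLaw d r, energy O R r V (Function.update ξ n x) (n + 1) ≤
        ENNReal.ofReal (c + 1 + pot - progressGain) +
          ENNReal.ofReal (progressGain + 2 * d) * F.indicator 1 x := by
      filter_upwards [ae_stepLaw_norm_le d r] with x hx
      have h := energy_succ_le hd hr hO hz hKR (ξ := Function.update ξ n x) (n := n)
        (fun h => hs ((hst x).1 h)) (by simpa using hx)
      rw [hcalls, outer_update, query_update] at h
      exact h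
    have hp := stepLaw_failSet_le hd hr hK hz v
    set p := (stepLaw d r).real F with hpdef
    have hp0 : 0 ≤ p := measureReal_nonneg
    refine (lintegral_mono_ae hbound).trans ?_
    rw [lintegral_add_left measurable_const, lintegral_const, measure_univ, mul_one,
      lintegral_const_mul' _ _ ENNReal.ofReal_ne_top]
    have hind : ∫⁻ x, F.indicator 1 x ∂stepLaw d r ≤ ENNReal.ofReal p := by
      rw [hpdef, ofReal_measureReal]
      exact lintegral_indicator_one_le F
    refine (add_le_add_right (mul_le_mul_right hind _) _).trans ?_
    rw [← ENNReal.ofReal_mul (by positivity), ← ENNReal.ofReal_add (by linarith) (by positivity),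
      energy, indicator_of_mem (by simpa using hs), ← ENNReal.ofReal_natCast,
      ← ENNReal.ofReal_add hc0 (by linarith)]
    refine ENNReal.ofReal_le_ofReal ?_
    -- the gain in the case of progress outweighs the cost
    have hkey : 1 + (progressGain + 2 * d) * p ≤ progressGain := by
      have h1 : progressGain * progressBound = 111 :=
        div_mul_cancel₀ _ (by unfold progressBound; positivity)
      have h2 : progressGain * p ≤ progressGain * (1 - progressBound) :=
        mul_le_mul_of_nonneg_left hp.2 hgain.le
      linarith [hp.1]
    linarith

/-- The radii of nested balls are ordered. -/
theorem radius_le_of_closedBall_subset (hd : 1 ≤ d) (hr : 0 < r) {z : Space d}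
    (h : Metric.closedBall z r ⊆ Metric.closedBall 0 R) : r ≤ R := by
  set e : Space d := r • EuclideanSpace.single ⟨0, hd⟩ (1 : ℝ) with he
  have hn : ‖e‖ = r := by simp [he, norm_smul, abs_of_pos hr]
  have h1 := h (show z + e ∈ Metric.closedBall z r by simp [hn])
  have h2 := h (show z - e ∈ Metric.closedBall z r by simp [hn])
  rw [mem_closedBall_zero_iff] at h1 h2
  have h3 := norm_sub_le (z + e) (z - e)
  have h4 : z + e - (z - e) = (2 : ℝ) • e := by rw [two_smul]; abel
  rw [h4, norm_smul, hn, Real.norm_ofNat] at h3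
  linarith

theorem lintegral_calls_le (hd : 1 ≤ d) (hr : 0 < r) (hK : Convex ℝ K)
    (hO : IsSeparationOracle K O) {z : Space d} (hz : Metric.closedBall z r ⊆ K)
    (hKR : K ⊆ Metric.closedBall 0 R) (hOm : AEMeasurable O volume) (n : ℕ) :
    ∫⁻ ξ, (calls O R r ξ n : ℝ≥0∞) ∂displacementLaw d r ≤
      ENNReal.ofReal ((2 + 40 * progressGain) * d * (1 + Real.log (R / r))) := by
  have hP := isProbabilityMeasure_displacementLaw hd hr
  set V := volume.real (Metric.closedBall z r) with hV
  have hrR := radius_le_of_closedBall_subset hd hr (hz.trans hKR)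
  have h1 : ∀ n, ∫⁻ ξ, energy O R r V ξ n ∂displacementLaw d r ≤
      ENNReal.ofReal (potential V (Metric.closedBall (0 : Space d) R)) := by
    intro n
    induction n with
    | zero =>
      have : ∀ ξ, energy O R r V ξ 0 =
          ENNReal.ofReal (potential V (Metric.closedBall (0 : Space d) R)) := by
        intro ξ
        have hs : ¬ Stopped O R r ξ 0 := by simp [Stopped, loop]
        rw [energy, indicator_of_mem (by simpa using hs)]
        simp [calls, outer, loop]
      simp [this]
    | succ n ih => exact (lintegral_energy_succ_le hd hr hK hO hz hKR hOm n).trans ih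
  refine (lintegral_mono fun ξ => le_self_add).trans ((h1 n).trans ?_)
  refine ENNReal.ofReal_le_ofReal ?_
  have hlog : Real.log (volume.real (Metric.closedBall (0 : Space d) R) / V) =
      d * Real.log (R / r) := by
    have hb := volume_real_closedBall_pos (0 : Space d) one_pos
    rw [hV, Measure.addHaar_real_closedBall' _ _ hr.le,
      Measure.addHaar_real_closedBall' _ _ (hr.le.trans hrR), finrank_euclideanSpace_fin,
      mul_div_mul_right _ _ hb.ne', ← div_pow, Real.log_pow]
  have hL : 0 ≤ Real.log (R / r) := Real.log_nonneg ((one_le_div hr).2 hrR)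
  have hd1 : (1 : ℝ) ≤ d := by exact_mod_cast hd
  have hg := progressGain_pos
  rw [potential, hlog]
  have h2 : progressGain ≤ 40 * progressGain * d := by nlinarith
  have h3 : 0 ≤ 2 * d * Real.log (R / r) := by positivity
  linarith

theorem oracleCalls_eq_iSup (ξ : ℕ → Space d) :
    oracleCalls O R r ξ = ⨆ n, (calls O R r ξ n : ℝ≥0∞) := rfl

end InnerBall

open InnerBall in
theorem mainTheorem5 :
    ∃ C : ℝ, 0 < C ∧
      ∀ (d : ℕ), 1 ≤ d →
      ∀ (K : Set (InnerBall.Space d)) (O : InnerBall.Space d → InnerBall.Answer d)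
        (z : InnerBall.Space d) (r R : ℝ),
        Convex ℝ K → 0 < r → Metric.closedBall z r ⊆ K → K ⊆ Metric.closedBall 0 R →
        InnerBall.IsSeparationOracle K O → AEMeasurable O volume →
        (∀ (ξ : ℕ → InnerBall.Space d) (x : InnerBall.Space d), InnerBall.Outputs O R r ξ x →
          Metric.closedBall x (r / (6 * (d : ℝ) ^ (7 / 2 : ℝ))) ⊆ K) ∧
        (∀ᵐ ξ ∂InnerBall.displacementLaw d r, ∃ x, InnerBall.Outputs O R r ξ x) ∧
        AEMeasurable (InnerBall.oracleCalls O R r) (InnerBall.displacementLaw d r) ∧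
        ∫⁻ ξ, InnerBall.oracleCalls O R r ξ ∂InnerBall.displacementLaw d r ≤
          ENNReal.ofReal (C * d * (1 + Real.log (R / r))) := by
  refine ⟨2 + 40 * progressGain, by linarith [progressGain_pos], ?_⟩
  intro d hd K O z r R hK hr hz hKR hO hOm
  have hc : ∀ n, AEMeasurable (fun ξ => (calls O R r ξ n : ℝ≥0∞)) (displacementLaw d r) :=
    fun n => (measurable_from_top (f := fun k : ℕ => (k : ℝ≥0∞))).comp_aemeasurable
      (measurable_state hd hr hO hKR hOm n).2.1
  have hmeas : AEMeasurable (oracleCalls O R r) (displacementLaw d r) := AEMeasurable.iSup hc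
  have hint : ∫⁻ ξ, oracleCalls O R r ξ ∂displacementLaw d r ≤
      ENNReal.ofReal ((2 + 40 * progressGain) * d * (1 + Real.log (R / r))) := by
    simp_rw [oracleCalls_eq_iSup]
    rw [lintegral_iSup' hc (ae_of_all _ fun ξ m n hmn =>
      Nat.cast_le.2 (monotone_calls ξ hmn))]
    exact iSup_le fun n => lintegral_calls_le hd hr hK hO hz hKR hOm n
  refine ⟨fun ξ x hx => ?_, ?_, hmeas, hint⟩
  · obtain ⟨h1, h2⟩ := hO.mem_of_outputs hx
    exact closedBall_subset_of_testPoints hd hK hr h1 h2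
  · filter_upwards [ae_lt_top' hmeas (hint.trans_lt ENNReal.ofReal_lt_top).ne] with ξ hξ
    by_contra hcon
    -- a run that never returns makes infinitely many calls
    have hns : ∀ n, ¬ Stopped O R r ξ n := by
      intro n hs
      obtain ⟨x, hx⟩ := Sum.isLeft_iff.1 hs
      exact hcon ⟨x, n, hx⟩
    refine hξ.ne (top_unique ?_)
    rw [← ENNReal.iSup_natCast, oracleCalls_eq_iSup]
    exact iSup_mono fun n => by exact_mod_cast le_calls_of_not_stopped (hns n)
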